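/- Let $\Bbbk$ be an algebraically closed field of characteristic $0$, and let $X$ be a union of conjugacy classes of a group, considered as a rack with $x\triangleright y=xyx^{-1}$. Say that $x,y\in X$ commute if $x\triangleright y=y$; write $x\square y$ if $x\triangleright y=y$ and $x\neq y$; and write $x_1x_2\cdots x_n\triangleright y=x_1\triangleright(x_2\triangleright(\cdots\triangleright(x_n\triangleright y)))$. Let $q\colon X\times X\to\Bbbk^\times$ be a two-cocycle, that is, $q_{x\triangleright y,x\triangleright z}\,q_{x,z}=q_{x,y\triangleright z}\,q_{y,z}$ for all $x,y,z\in X$. Let $V=\Bbbk X$ be the vector space with basis $(v_x)_{x\in X}$ and braiding $c_q(v_x\otimes v_y)=q_{x,y}\,v_{x\triangleright y}\otimes v_x$, regarded as a Yetter–Drinfeld module over the enveloping group $G_X=\langle g_x,\ x\in X\mid g_xg_y=g_{x\triangleright y}g_x\rangle$ by $g_x\cdot v_y=q_{x,y}v_{x\triangleright y}$ and $\deg v_x=g_x$. Let $c_i$ denote $c_q$ applied to the tensor factors $i,i+1$ of $V^{\otimes n}$. Let $\mathcal B(V)=\bigoplus_{n\ge 0}V^{\otimes n}/\ker S_n$ be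 the Nichols algebra, where $S_n=\sum_{s\in\mathbb S_n}c_{i_1}\cdots c_{i_m}$ (with $s=s_{i_1}\cdots s_{i_m}$ a reduced expression) is the braided symmetrizer, let $\mu\colon V^{\otimes n}\to\mathcal B(V)$ be the multiplication, and let $\Delta$ be the comultiplication of $\mathcal B(V)$. A left coideal subalgebra of $\mathcal B(V)$ in the category of $\mathbb N_0$-graded $\Bbbk G_X$-comodules is a subalgebra $C\subseteq\mathcal B(V)$ that is a graded subspace for the $\mathbb N_0$-grading and for the $G_X$-grading and satisfies $\Delta(C)\subseteq\mathcal B(V)\otimes C$. It is generated in degree one if it is generated, as an algebra, by $C(1)=C\cap V$. Assume that $X$ is braided, i.e. $x\triangleright x=x$ and ($x\triangleright y=y$ or $x\triangleright(y\triangleright x)=y$) for all $x,y\in X$, and that $\mathcal B(V)$ is slim in degree two, i.e. $\mu(\mathrm{id}-c_q)(v_x\otimes v_y)=0$ whenever $x\triangleright y=y\neq x$, and $\mu(\mathrm{id}-c_q+c_q^2)(v_x\otimes v_y)=0$ whenever $x\triangleright y\neq y$. Let $a,b,c,d\in X$ be elements such that $a\square c$, such that no other two of $a,b,c,d$ commute,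 and such that $b\square(c\triangleright d)$ and $a\square(b\triangleright d)$. Put $e=abc\triangleright d$, $f=eab\triangleright c$, $g=fea\triangleright b$, and $$Z=\mu\bigl(\mathrm{id}-c_1c_2c_3+(c_1c_2c_3)^2-(c_1c_2c_3)^3\bigr)(v_a\otimes v_b\otimes v_c\otimes v_d)\in\mathcal B(V).$$ Let $C$ be the subalgebra (with one) of $\mathcal B(V)$ generated by $v_b,v_c,v_d,v_e,v_f,v_g$ and $Z$. Then: 1. $C$ is a left coideal subalgebra of $\mathcal B(V)$ in the category of $\mathbb N_0$-graded $\Bbbk G_X$-comodules. 2. If $e\neq d$, $f\neq c$ or $g\neq b$, then $C$ is not generated in degree one. -/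

import Mathlib

open scoped Quandles TensorProduct

noncomputable section

namespace RackNichols

/-! ### Reduced words of permutations -/

/-- The simple transposition `(i i+1)` of `Fin n` (positions counted from `0`). -/
def adjSwap (n i : ℕ) : Equiv.Perm (Fin n) :=
  if h : i + 1 < n then Equiv.swap ⟨i, by omega⟩ ⟨i + 1, h⟩ else 1

/-- Every permutation of `Fin (n + 1)` is in a unique way the product of a permutation fixing `0`,
that is, of a permutation of the last `n` points, and of the cycle `s₀ s₁ ⋯ s_{k-1}`, which is
`Fin.cycleRange k`. -/
def permSplit (n : ℕ) : Equiv.Perm (Fin (n + 1)) ≃ Fin (n + 1) × Equiv.Perm (Fin n) where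
  toFun s := (s.symm 0, (Equiv.Perm.decomposeFin (s * (Fin.cycleRange (s.symm 0))⁻¹)).2)
  invFun p := Equiv.Perm.decomposeFin.symm (0, p.2) * Fin.cycleRange p.1
  left_inv s := by
    have h0 : (s * (Fin.cycleRange (s.symm 0))⁻¹) 0 = 0 := by
      have := Fin.cycleRange_symm_zero (s.symm 0)
      simp [Equiv.Perm.mul_apply, Equiv.Perm.inv_def, this]
    have h1 : (0, (Equiv.Perm.decomposeFin (s * (Fin.cycleRange (s.symm 0))⁻¹)).2)
        = Equiv.Perm.decomposeFin (s * (Fin.cycleRange (s.symm 0))⁻¹) := by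
      refine Prod.ext ?_ rfl
      have h2 := Equiv.Perm.decomposeFin_symm_apply_zero
        (Equiv.Perm.decomposeFin (s * (Fin.cycleRange (s.symm 0))⁻¹)).1
        (Equiv.Perm.decomposeFin (s * (Fin.cycleRange (s.symm 0))⁻¹)).2
      rw [Prod.mk.eta, Equiv.symm_apply_apply, h0] at h2
      exact h2
    simp only
    rw [h1, Equiv.symm_apply_apply, inv_mul_cancel_right]
  right_inv := by
    rintro ⟨k, s⟩
    have hk : (Equiv.Perm.decomposeFin.symm (0, s) * Fin.cycleRange k).symm 0 = k := by
      rw [Equiv.symm_apply_eq]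
      simp [Equiv.Perm.mul_apply]
    simp only [hk, mul_inv_cancel_right, Equiv.apply_symm_apply]

/-- A reduced expression of the permutation `s`, as the list of the indices of its simple
transpositions; see `redWord_prod` and `length_redWord_le`. -/
def redWord : (n : ℕ) → Equiv.Perm (Fin n) → List ℕ
  | 0, _ => []
  | n + 1, s => (redWord n (permSplit n s).2).map Nat.succ ++ List.range (permSplit n s).1

theorem coe_adjSwap (n i : ℕ) (h : i + 1 < n) (j : Fin n) : ((adjSwap n i j : Fin n) : ℕ) =
    if (j : ℕ) = i then i + 1 else if (j : ℕ) = i + 1 then i else j := by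
  simp only [adjSwap, h, dite_true, Equiv.swap_apply_def, Fin.ext_iff]
  split_ifs <;> simp

theorem coe_cycleRange {n : ℕ} (k j : Fin n) : ((Fin.cycleRange k j : Fin n) : ℕ) =
    if (j : ℕ) < k then (j : ℕ) + 1 else if (j : ℕ) = k then 0 else j := by
  rcases lt_trichotomy j k with h | h | h
  · rw [Fin.coe_cycleRange_of_lt h, if_pos (Fin.lt_def.1 h)]
  · subst h
    rw [Fin.coe_cycleRange_of_le le_rfl]; simp
  · rw [Fin.cycleRange_of_gt h, if_neg (by exact not_lt.2 h.le), if_neg (by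
      intro h2; exact absurd (Fin.ext h2) h.ne')]

theorem cycleRange_eq_prod (n : ℕ) (k : ℕ) (hk : k < n) :
    ((List.range k).map (adjSwap n)).prod = Fin.cycleRange (⟨k, hk⟩ : Fin n) := by
  induction k with
  | zero =>
    ext j; rw [coe_cycleRange]
    by_cases h : (j : ℕ) = 0 <;> simp [h]
  | succ k ih =>
    rw [List.range_succ, List.map_append, List.prod_append, ih (by omega)]
    ext j
    simp only [List.map_cons, List.map_nil, List.prod_cons, List.prod_nil, mul_one,
      Equiv.Perm.mul_apply]
    rw [coe_cycleRange, coe_cycleRange, coe_adjSwap n k hk]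
    simp only
    split_ifs <;> omega

theorem shift_adjSwap (n i : ℕ) :
    Equiv.Perm.decomposeFin.symm (0, adjSwap n i) = adjSwap (n + 1) (i + 1) := by
  ext j
  refine Fin.cases ?_ (fun j => ?_) j
  · by_cases h : i + 1 < n
    · rw [coe_adjSwap _ _ (by omega)]; simp
    · simp [adjSwap, h]
  · rw [Equiv.Perm.decomposeFin_symm_apply_succ]
    by_cases h : i + 1 < n
    · rw [coe_adjSwap _ _ (by omega)]
      simp only [Equiv.swap_self, Equiv.refl_apply, Fin.val_succ]
      rw [coe_adjSwap _ _ h]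
      split_ifs <;> omega
    · simp [adjSwap, h]

theorem shift_mul (n : ℕ) (s t : Equiv.Perm (Fin n)) :
    Equiv.Perm.decomposeFin.symm (0, s * t)
      = Equiv.Perm.decomposeFin.symm (0, s) * Equiv.Perm.decomposeFin.symm (0, t) := by
  ext j
  refine Fin.cases ?_ (fun j => ?_) j <;> simp [Equiv.Perm.mul_apply]

theorem shift_prod (n : ℕ) (l : List ℕ) :
    Equiv.Perm.decomposeFin.symm (0, (l.map (adjSwap n)).prod)
      = ((l.map Nat.succ).map (adjSwap (n + 1))).prod := by
  induction l with
  | nil => ext j; refine Fin.cases ?_ (fun j => ?_) j <;> simp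
  | cons i l ih => simp only [List.map_cons, List.prod_cons, shift_mul, ih, shift_adjSwap]

/-- `redWord n s` is an expression of `s` in the simple transpositions. -/
theorem redWord_prod (n : ℕ) (s : Equiv.Perm (Fin n)) :
    ((redWord n s).map (adjSwap n)).prod = s := by
  induction n with
  | zero => exact Subsingleton.elim _ _
  | succ n ih =>
    rw [redWord, List.map_append, List.prod_append, ← shift_prod, ih, cycleRange_eq_prod _ _ (permSplit n s).1.2]
    exact (permSplit n).symm_apply_apply s

theorem redWord_one (n : ℕ) : redWord n 1 = [] := by
  induction n with
  | zero => rfl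
  | succ n ih =>
    have : permSplit n 1 = (0, 1) := by
      rw [← Equiv.eq_symm_apply]
      ext j; refine Fin.cases ?_ (fun j => ?_) j <;> simp [permSplit]
    rw [redWord, this, ih]; simp

theorem length_redWord_mul (n : ℕ) (s : Equiv.Perm (Fin n)) (i : ℕ) :
    (redWord n (s * adjSwap n i)).length ≤ (redWord n s).length + 1 := by
  induction n generalizing i with
  | zero => simp [redWord]
  | succ n ih =>
    by_cases hi : i + 1 < n + 1
    swap
    · simp [adjSwap, hi]
    obtain ⟨⟨k, u⟩, rfl⟩ := (permSplit n).symm.surjective s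
    have hsplit : ∀ (k' : Fin (n + 1)) (u' : Equiv.Perm (Fin n)),
        (permSplit n).symm (k, u) * adjSwap (n + 1) i = (permSplit n).symm (k', u') →
        (redWord (n + 1) ((permSplit n).symm (k, u) * adjSwap (n + 1) i)).length
          = (redWord n u').length + k' := by
      intro k' u' h
      rw [h, redWord, Equiv.apply_symm_apply]; simp
    have hlen : (redWord (n + 1) ((permSplit n).symm (k, u))).length
        = (redWord n u).length + k := by
      rw [redWord, Equiv.apply_symm_apply]; simp
    rw [hlen]
    have hdef : ∀ (k' : Fin (n + 1)) (u' : Equiv.Perm (Fin n)), (permSplit n).symm (k', u')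
        = Equiv.Perm.decomposeFin.symm (0, u') * Fin.cycleRange k' := fun _ _ => rfl
    rcases Nat.lt_trichotomy i k with h | h | h
    · by_cases h2 : i + 1 = k
      · rw [hsplit ⟨i, by omega⟩ u]
        · simp only; omega
        · rw [hdef, hdef, mul_assoc]
          congr 1
          ext j
          rw [Equiv.Perm.mul_apply, coe_cycleRange, coe_cycleRange, coe_adjSwap _ _ hi]
          simp only
          split_ifs <;> omega
      · have h3 : (k : ℕ) < n + 1 := k.2
        rw [hsplit k (u * adjSwap n i)]
        · have := ih u i; omega
        · rw [hdef, hdef, shift_mul, mul_assoc, mul_assoc, shift_adjSwap]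
          congr 1
          ext j
          rw [Equiv.Perm.mul_apply, Equiv.Perm.mul_apply, coe_cycleRange,
            coe_adjSwap _ _ hi, coe_adjSwap _ _ (by omega), coe_cycleRange]
          split_ifs <;> omega
    · rw [hsplit ⟨i + 1, by omega⟩ u]
      · simp only; omega
      · rw [hdef, hdef, mul_assoc]
        congr 1
        ext j
        rw [Equiv.Perm.mul_apply, coe_cycleRange, coe_cycleRange, coe_adjSwap _ _ hi]
        simp only
        split_ifs <;> omega
    · obtain ⟨i, rfl⟩ : ∃ m, i = m + 1 := ⟨i - 1, by omega⟩
      rw [hsplit k (u * adjSwap n i)]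
      · have := ih u i; omega
      · rw [hdef, hdef, shift_mul, mul_assoc, mul_assoc, shift_adjSwap]
        congr 1
        ext j
        rw [Equiv.Perm.mul_apply, Equiv.Perm.mul_apply, coe_cycleRange,
            coe_adjSwap _ _ hi, coe_adjSwap _ _ (by omega), coe_cycleRange]
        split_ifs <;> omega

/-- `redWord n s` is reduced: no expression of `s` in the simple transpositions is shorter. -/
theorem length_redWord_le (n : ℕ) (l : List ℕ) :
    (redWord n (l.map (adjSwap n)).prod).length ≤ l.length := by
  induction l using List.reverseRecOn with
  | nil => simp [redWord_one]
  | append_singleton l i ih =>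
    rw [List.map_append, List.prod_append, List.length_append]
    simpa using (length_redWord_mul n _ i).trans (Nat.succ_le_succ ih)

/-! ### The tensor algebra of the vector space with basis `X` -/


variable {𝕜 : Type*} {X : Type*} [Field 𝕜]

/-- The tensor algebra of the vector space with basis `X`: its basis consists of the words in `X`,
multiplied by concatenation, and the words of length `n` form the standard basis of the `n`-th
tensor power. -/
abbrev TensorAlg (𝕜 X : Type*) [Field 𝕜] := MonoidAlgebra 𝕜 (FreeMonoid X)

/-- The pure tensor `x₁ ⊗ ⋯ ⊗ xₙ` of basis vectors. -/
def word (𝕜 : Type*) {X : Type*} [Field 𝕜] (w : List X) : TensorAlg 𝕜 X :=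
  MonoidAlgebra.single (FreeMonoid.ofList w) 1

/-- The linear map with prescribed values on the basis of words. -/
def onWords {M : Type*} [AddCommGroup M] [Module 𝕜 M] (f : List X → M) :
    TensorAlg 𝕜 X →ₗ[𝕜] M :=
  Finsupp.linearCombination 𝕜 (fun w : FreeMonoid X => f w.toList) ∘ₗ
    (MonoidAlgebra.coeffLinearEquiv 𝕜).toLinearMap

@[simp] lemma onWords_word {M : Type*} [AddCommGroup M] [Module 𝕜 M] (f : List X → M)
    (w : List X) : onWords f (word 𝕜 w) = f w := by
  simp [onWords, word]

lemma ext_words {M : Type*} [AddCommGroup M] [Module 𝕜 M] {f g : TensorAlg 𝕜 X →ₗ[𝕜] M}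
    (h : ∀ w, f (word 𝕜 w) = g (word 𝕜 w)) : f = g := by
  apply MonoidAlgebra.lhom_ext'
  intro w
  apply LinearMap.ext_ring
  exact h w.toList

lemma word_nil : word 𝕜 ([] : List X) = 1 := rfl

lemma word_mul (u v : List X) : word 𝕜 u * word 𝕜 v = word 𝕜 (u ++ v) := by
  simp [word, MonoidAlgebra.single_mul_single]

lemma word_cons (x : X) (v : List X) : word 𝕜 (x :: v) = word 𝕜 [x] * word 𝕜 v := by
  simp [word_mul]

/-- Left multiplication by the basis vector `x`. -/
def consL (x : X) : TensorAlg 𝕜 X →ₗ[𝕜] TensorAlg 𝕜 X := LinearMap.mulLeft 𝕜 (word 𝕜 [x])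

@[simp] lemma consL_word (x : X) (w : List X) : consL x (word 𝕜 w) = word 𝕜 (x :: w) := by
  simp [consL, word_mul]


/-! ### helper -/

open Classical in
/-- The linear map `y ⊗ t ↦ t` and `x ⊗ t ↦ 0` for `x ≠ y`. -/
def strip (y : X) : Module.End 𝕜 (TensorAlg 𝕜 X) :=
  onWords fun w => match w with
    | [] => 0
    | x :: u => if x = y then word 𝕜 u else 0

/-- The projection to degree zero. -/
def eps : TensorAlg 𝕜 X →ₗ[𝕜] 𝕜 :=
  onWords fun w => match w with
    | [] => 1
    | _ :: _ => 0

@[simp] lemma eps_consL (x : X) (t : TensorAlg 𝕜 X) : eps (consL x t) = 0 := by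
  have : (eps ∘ₗ consL x : TensorAlg 𝕜 X →ₗ[𝕜] 𝕜) = 0 := ext_words fun w => by simp [eps]
  exact LinearMap.congr_fun this t

@[simp] lemma eps_nil : eps (word 𝕜 ([] : List X)) = 1 := by simp [eps]

@[simp] lemma strip_nil (y : X) : strip y (word 𝕜 []) = 0 := by simp [strip]

open Classical in
lemma strip_consL (x y : X) (t : TensorAlg 𝕜 X) :
    strip y (consL x t) = if x = y then t else 0 := by
  have : (strip y ∘ₗ consL x : Module.End 𝕜 (TensorAlg 𝕜 X))
      = if x = y then LinearMap.id else 0 :=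
    ext_words fun w => by by_cases h : x = y <;> simp [strip, h]
  have := LinearMap.congr_fun this t
  by_cases h : x = y <;> simpa [h] using this

/-- The coefficient of the word `w`. -/
def coeffW (w : List X) : TensorAlg 𝕜 X →ₗ[𝕜] 𝕜 :=
  Finsupp.lapply (FreeMonoid.ofList w) ∘ₗ (MonoidAlgebra.coeffLinearEquiv 𝕜).toLinearMap

open Classical in
lemma coeffW_word (u v : List X) : coeffW u (word 𝕜 v) = if v = u then 1 else 0 := by
  have : (FreeMonoid.ofList v = FreeMonoid.ofList u) ↔ v = u := Iff.rfl
  change (Finsupp.single (FreeMonoid.ofList v) (1 : 𝕜)) (FreeMonoid.ofList u) = _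
  rw [Finsupp.single_apply]
  simp only [this]

lemma coeffW_nil : (coeffW [] : TensorAlg 𝕜 X →ₗ[𝕜] 𝕜) = eps := by
  refine ext_words fun w => ?_
  cases w with
  | nil => simp [coeffW_word]
  | cons x u => rw [coeffW_word, ← consL_word, eps_consL]; simp

lemma coeffW_cons (y : X) (u : List X) :
    (coeffW (y :: u) : TensorAlg 𝕜 X →ₗ[𝕜] 𝕜) = coeffW u ∘ₗ strip y := by
  classical
  refine ext_words fun w => ?_
  cases w with
  | nil => simp [coeffW_word]
  | cons x v =>
    rw [LinearMap.comp_apply, ← consL_word, strip_consL, consL_word, coeffW_word]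
    by_cases h : x = y <;> simp [h, coeffW_word]

lemma eq_zero_of_strip {t : TensorAlg 𝕜 X} (h0 : eps t = 0) (h : ∀ y, strip y t = 0) : t = 0 := by
  have key : ∀ w : List X, coeffW w t = 0 := by
    intro w
    cases w with
    | nil => rw [coeffW_nil, h0]
    | cons y u => rw [coeffW_cons, LinearMap.comp_apply, h, map_zero]
  apply (MonoidAlgebra.coeffLinearEquiv 𝕜).injective
  ext w
  exact (key w.toList).trans (by simp)

/-- The basis of words. -/
def wordBasis : Module.Basis (FreeMonoid X) 𝕜 (TensorAlg 𝕜 X) :=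
  ⟨MonoidAlgebra.coeffLinearEquiv 𝕜⟩

lemma tensor_eq_zero {M : Type*} [AddCommGroup M] [Module 𝕜 M] (z : TensorAlg 𝕜 X ⊗[𝕜] M)
    (h0 : LinearMap.rTensor M eps z = 0)
    (h : ∀ y, LinearMap.rTensor M (strip y) z = 0) : z = 0 := by
  have key : ∀ w : List X, LinearMap.rTensor M (coeffW w) z = 0 := by
    intro w
    cases w with
    | nil => rw [coeffW_nil, h0]
    | cons y u => rw [coeffW_cons, LinearMap.rTensor_comp, LinearMap.comp_apply, h, map_zero]
  classical
  apply (TensorProduct.equivFinsuppOfBasisLeft (wordBasis (𝕜 := 𝕜) (X := X))).injective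
  ext w
  rw [TensorProduct.equivFinsuppOfBasisLeft_apply]
  have : (wordBasis (𝕜 := 𝕜) (X := X)).coord w = coeffW w.toList := by
    ext t; rfl
  rw [this, key]; simp

/-- The `n`-th tensor power, as the degree `n` part of the tensor algebra. -/
def wordsLen (𝕜 X : Type*) [Field 𝕜] (n : ℕ) : Submodule 𝕜 (TensorAlg 𝕜 X) :=
  Submodule.span 𝕜 {t | ∃ w : List X, w.length = n ∧ t = word 𝕜 w}

lemma eps_of_len (n : ℕ) (t : TensorAlg 𝕜 X) (ht : t ∈ wordsLen 𝕜 X (n + 1)) : eps t = 0 := by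
  induction ht using Submodule.span_induction with
  | mem t ht =>
    obtain ⟨w, hw, rfl⟩ := ht
    cases w with
    | nil => simp at hw
    | cons x u => rw [← consL_word, eps_consL]
  | zero => simp
  | add a b _ _ ha hb => simp [ha, hb]
  | smul c a _ ha => simp [ha]

lemma strip_mem (y : X) (n : ℕ) (t : TensorAlg 𝕜 X) (ht : t ∈ wordsLen 𝕜 X (n + 1)) :
    strip y t ∈ wordsLen 𝕜 X n := by
  classical
  induction ht using Submodule.span_induction with
  | mem t ht =>
    obtain ⟨w, hw, rfl⟩ := ht
    cases w with
    | nil => simp at hw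
    | cons x u =>
      rw [← consL_word, strip_consL]
      by_cases h : x = y
      · simp only [h, if_true]
        exact Submodule.subset_span ⟨u, by simpa using hw, rfl⟩
      · simp [h]
  | zero => simp
  | add a b _ _ ha hb => simpa using Submodule.add_mem _ ha hb
  | smul c a _ ha => simpa using Submodule.smul_mem _ c ha

/-- The part of the tensor algebra of degrees at most `n`. -/
def wordsLE (𝕜 X : Type*) [Field 𝕜] (n : ℕ) : Submodule 𝕜 (TensorAlg 𝕜 X) :=
  Submodule.span 𝕜 {t | ∃ w : List X, w.length ≤ n ∧ t = word 𝕜 w}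

lemma exists_mem_wordsLE (t : TensorAlg 𝕜 X) : ∃ n, t ∈ wordsLE 𝕜 X n := by
  have hmono : ∀ m n, m ≤ n → wordsLE 𝕜 X m ≤ wordsLE 𝕜 X n := fun m n h =>
    Submodule.span_mono fun t ⟨w, hw, ht⟩ => ⟨w, hw.trans h, ht⟩
  induction t using MonoidAlgebra.induction_linear with
  | zero => exact ⟨0, Submodule.zero_mem _⟩
  | add f g hf hg =>
    obtain ⟨m, hm⟩ := hf
    obtain ⟨n, hn⟩ := hg
    exact ⟨max m n, Submodule.add_mem _ (hmono _ _ (le_max_left _ _) hm)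
      (hmono _ _ (le_max_right _ _) hn)⟩
  | single w r =>
    refine ⟨w.toList.length, ?_⟩
    have : MonoidAlgebra.single w r = r • word 𝕜 w.toList := by simp [word]
    rw [this]
    exact Submodule.smul_mem _ _ (Submodule.subset_span ⟨_, le_rfl, rfl⟩)

lemma consL_mem_LE (x : X) (n : ℕ) (t : TensorAlg 𝕜 X) (ht : t ∈ wordsLE 𝕜 X n) :
    consL x t ∈ wordsLE 𝕜 X (n + 1) := by
  induction ht using Submodule.span_induction with
  | mem t ht =>
    obtain ⟨w, hw, rfl⟩ := ht
    exact Submodule.subset_span ⟨x :: w, by simpa using hw, by simp⟩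
  | zero => simp
  | add a b _ _ ha hb => simpa using Submodule.add_mem _ ha hb
  | smul c a _ ha => simpa using Submodule.smul_mem _ c ha

lemma eq_zero_of_LE_zero (t : TensorAlg 𝕜 X) (ht : t ∈ wordsLE 𝕜 X 0) (h : eps t = 0) :
    t = 0 := by
  have : t = eps t • word 𝕜 [] := by
    clear h
    induction ht using Submodule.span_induction with
    | mem t ht =>
      obtain ⟨w, hw, rfl⟩ := ht
      have : w = [] := by simpa using hw
      subst this; simp
    | zero => simp
    | add a b _ _ ha hb => rw [map_add, add_smul, ← ha, ← hb]
    | smul c a _ ha => rw [map_smul, smul_assoc, ← ha]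
  rw [this, h, zero_smul]

lemma consL_mul (x : X) (s t : TensorAlg 𝕜 X) : consL x (s * t) = consL x s * t := by
  simp [consL, mul_assoc]

lemma eps_mulLetter (x : X) (t : TensorAlg 𝕜 X) : eps (t * word 𝕜 [x]) = 0 := by
  have : eps ∘ₗ LinearMap.mulRight 𝕜 (word 𝕜 [x]) = 0 := by
    refine ext_words fun w => ?_
    cases w with
    | nil =>
      simp only [LinearMap.comp_apply, LinearMap.mulRight_apply, word_mul, List.nil_append]
      rw [← consL_word, eps_consL]; rfl
    | cons z u =>
      rw [LinearMap.comp_apply, LinearMap.mulRight_apply, ← consL_word, ← consL_mul, eps_consL]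
      rfl
  exact LinearMap.congr_fun this t

variable [Rack X]

/-! ### Racks, two-cocycles and the braided vector space -/

/-- A (scalar valued) two-cocycle on a rack. -/
structure TwoCocycle (𝕜 X : Type*) [Field 𝕜] [Rack X] where
  toFun : X → X → 𝕜ˣ
  cocycle : ∀ x y z, toFun (x ◃ y) (x ◃ z) * toFun x z = toFun x (y ◃ z) * toFun y z

instance : CoeFun (TwoCocycle 𝕜 X) (fun _ => X → X → 𝕜ˣ) := ⟨TwoCocycle.toFun⟩

variable (q : TwoCocycle 𝕜 X)

/-- The value on a word of the braiding `c(x ⊗ y) = q_{x,y} (x ◃ y) ⊗ x`, applied at the letters at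
positions `i` and `i + 1` (counted from `0`). Words that are too short have no such letters, the
map is not used there and is set to `0`. -/
def braidWord : ℕ → List X → TensorAlg 𝕜 X
  | 0, x :: y :: w => (q x y : 𝕜) • word 𝕜 ((x ◃ y) :: x :: w)
  | i + 1, x :: w => consL x (braidWord i w)
  | _, _ => 0

/-- The map `c_{i+1}` on all tensor powers: the braiding at positions `i` and `i + 1`, counted
from `0`. -/
def braid (i : ℕ) : Module.End 𝕜 (TensorAlg 𝕜 X) := onWords (braidWord q i)

/-- The composition `c_{i₁} c_{i₂} ⋯ c_{iₘ}`. -/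
def braidProd (l : List ℕ) : Module.End 𝕜 (TensorAlg 𝕜 X) := (l.map (braid q)).prod

/-- The braided symmetrizer: on the `n`-th tensor power it is `Sₙ = ∑ₛ τ(ν(s))`, the sum over all
permutations `s` of `n` points of the maps `c_{i₁} ⋯ c_{iₘ}` of a reduced expression of `s`. -/
def symmetrizer : Module.End 𝕜 (TensorAlg 𝕜 X) :=
  onWords fun w => ∑ s : Equiv.Perm (Fin w.length), braidProd q (redWord w.length s) (word 𝕜 w)

/-- The action of the generator `g_x` of the enveloping group on the tensor algebra: the algebra map
with `y ↦ q_{x,y} (x ◃ y)`. -/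
def actT (x : X) : TensorAlg 𝕜 X →ₐ[𝕜] TensorAlg 𝕜 X :=
  MonoidAlgebra.lift 𝕜 (TensorAlg 𝕜 X) (FreeMonoid X)
    (FreeMonoid.lift fun y => (q x y : 𝕜) • word 𝕜 [x ◃ y])

/-- Left multiplication by `x ⊗ 1 + 1 ⊗ x` in the braided tensor product algebra `T ⊗ T`, whose
product is `(s ⊗ t)(s' ⊗ t') = s (g_t · s') ⊗ t t'` for words `t` of degree `g_t`:
`s' ⊗ t' ↦ x s' ⊗ t' + (g_x · s') ⊗ x t'`. -/
def coprodLetter (x : X) : Module.End 𝕜 (TensorAlg 𝕜 X ⊗[𝕜] TensorAlg 𝕜 X) :=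
  TensorProduct.map (consL x) LinearMap.id + TensorProduct.map (actT q x).toLinearMap (consL x)

/-- The comultiplication of the tensor algebra: the algebra map to the braided tensor product algebra
`T ⊗ T` with `x ↦ x ⊗ 1 + 1 ⊗ x` for all `x` in `X`. -/
def comulT : TensorAlg 𝕜 X →ₗ[𝕜] TensorAlg 𝕜 X ⊗[𝕜] TensorAlg 𝕜 X :=
  onWords fun w => (w.map (coprodLetter q)).prod (1 ⊗ₜ 1)



/-! ### The kernel of the braided symmetrizer is an ideal -/

lemma braid_zero_consL (x y : X) (t : TensorAlg 𝕜 X) :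
    strip y (braid q 0 (consL x t)) = (q x (x ◃⁻¹ y) : 𝕜) • consL x (strip (x ◃⁻¹ y) t) := by
  classical
  have : strip y ∘ₗ braid q 0 ∘ₗ consL x
      = (q x (x ◃⁻¹ y) : 𝕜) • (consL x ∘ₗ strip (x ◃⁻¹ y)) := by
    refine ext_words fun w => ?_
    cases w with
    | nil => simp [braid, braidWord]
    | cons z u =>
      have hz : x ◃ z = y ↔ z = x ◃⁻¹ y := by
        constructor
        · rintro rfl; simp
        · rintro rfl; simp
      simp only [LinearMap.comp_apply, consL_word, braid, onWords_word, braidWord, map_smul,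
        LinearMap.smul_apply]
      rw [← consL_word, strip_consL, ← consL_word z, strip_consL]
      by_cases h : x ◃ z = y
      · simp [hz.1 h]
      · simp [h, mt hz.2 h]
  exact LinearMap.congr_fun this t

lemma braid_succ_consL (i : ℕ) (x : X) (t : TensorAlg 𝕜 X) :
    braid q (i + 1) (consL x t) = consL x (braid q i t) := by
  have : braid q (i + 1) ∘ₗ consL x = consL x ∘ₗ braid q i :=
    ext_words fun w => by simp [braid, braidWord]
  exact LinearMap.congr_fun this t

lemma braidProd_map_succ (l : List ℕ) (x : X) (t : TensorAlg 𝕜 X) :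
    braidProd q (l.map Nat.succ) (consL x t) = consL x (braidProd q l t) := by
  induction l generalizing t with
  | nil => simp [braidProd]
  | cons i l ih =>
    simp only [braidProd, List.map_cons, List.prod_cons, Module.End.mul_apply] at ih ⊢
    rw [ih, Nat.succ_eq_add_one, braid_succ_consL]

lemma braidProd_append (l m : List ℕ) :
    braidProd q (l ++ m) = braidProd q l * braidProd q m := by
  simp [braidProd]

/-- `1 + c₁ + c₁c₂ + ⋯ + c₁⋯c_{n-1}` -/
def comulOne : Module.End 𝕜 (TensorAlg 𝕜 X) :=
  onWords fun w => ∑ k : Fin w.length, braidProd q (List.range k) (word 𝕜 w)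

/-- The skew derivations `∂_y`, with `Δ_{1,n-1}(t) = ∑_y y ⊗ ∂_y(t)`. -/
def partialD (y : X) : Module.End 𝕜 (TensorAlg 𝕜 X) := strip y ∘ₗ comulOne q

lemma braid_mem (i n : ℕ) (t : TensorAlg 𝕜 X) (ht : t ∈ wordsLen 𝕜 X n) :
    braid q i t ∈ wordsLen 𝕜 X n := by
  induction ht using Submodule.span_induction with
  | mem t ht =>
    obtain ⟨w, rfl, rfl⟩ := ht
    clear t
    simp only [braid, onWords_word]
    induction w generalizing i with
    | nil => simp [braidWord]
    | cons x u ih =>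
      cases i with
      | zero =>
        cases u with
        | nil => simp [braidWord]
        | cons y v => exact Submodule.smul_mem _ _ (Submodule.subset_span ⟨_, by simp, rfl⟩)
      | succ i =>
        simp only [braidWord]
        have : ∀ t ∈ wordsLen 𝕜 X u.length, consL x t ∈ wordsLen 𝕜 X (x :: u).length := by
          intro t ht
          induction ht using Submodule.span_induction with
          | mem t ht =>
            obtain ⟨w, hw, rfl⟩ := ht
            exact Submodule.subset_span ⟨x :: w, by simp [hw], by simp⟩
          | zero => simp
          | add a b _ _ ha hb => simpa using Submodule.add_mem _ ha hb
          | smul c a _ ha => simpa using Submodule.smul_mem _ c ha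
        exact this _ (ih i)
  | zero => simp
  | add a b _ _ ha hb => simpa using Submodule.add_mem _ ha hb
  | smul c a _ ha => simpa using Submodule.smul_mem _ c ha

lemma braidProd_mem (l : List ℕ) (n : ℕ) (t : TensorAlg 𝕜 X) (ht : t ∈ wordsLen 𝕜 X n) :
    braidProd q l t ∈ wordsLen 𝕜 X n := by
  induction l with
  | nil => simpa [braidProd] using ht
  | cons i l ih => simpa [braidProd] using braid_mem q i n _ ih

lemma symmetrizer_of_len (n : ℕ) (t : TensorAlg 𝕜 X) (ht : t ∈ wordsLen 𝕜 X n) :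
    symmetrizer q t = ∑ s : Equiv.Perm (Fin n), braidProd q (redWord n s) t := by
  induction ht using Submodule.span_induction with
  | mem t ht => obtain ⟨w, rfl, rfl⟩ := ht; simp [symmetrizer]
  | zero => simp
  | add a b _ _ ha hb => simp [ha, hb, Finset.sum_add_distrib]
  | smul c a _ ha => simp [ha, Finset.smul_sum]

lemma strip_braidProd_succ (l : List ℕ) (y : X) (n : ℕ) (t : TensorAlg 𝕜 X)
    (ht : t ∈ wordsLen 𝕜 X (n + 1)) :
    strip y (braidProd q (l.map Nat.succ) t) = braidProd q l (strip y t) := by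
  classical
  induction ht using Submodule.span_induction with
  | mem t ht =>
    obtain ⟨w, hw, rfl⟩ := ht
    cases w with
    | nil => simp at hw
    | cons x u =>
      rw [← consL_word, braidProd_map_succ, strip_consL, strip_consL]
      by_cases h : x = y <;> simp [h]
  | zero => simp
  | add a b _ _ ha hb => simp [ha, hb]
  | smul c a _ ha => simp [ha]

lemma eps_symmetrizer (t : TensorAlg 𝕜 X) : eps (symmetrizer q t) = eps t := by
  have : eps ∘ₗ symmetrizer q = eps := by
    refine ext_words fun w => ?_
    have hw : word 𝕜 w ∈ wordsLen 𝕜 X w.length := Submodule.subset_span ⟨w, rfl, rfl⟩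
    rw [LinearMap.comp_apply]
    cases w with
    | nil => simp [symmetrizer, braidProd, redWord]
    | cons x u =>
      rw [eps_of_len u.length _ hw, symmetrizer_of_len q _ _ hw, map_sum]
      exact Finset.sum_eq_zero fun s _ => eps_of_len u.length _ (braidProd_mem q _ _ _ hw)
  exact LinearMap.congr_fun this t

lemma strip_symmetrizer (y : X) (t : TensorAlg 𝕜 X) :
    strip y (symmetrizer q t) = symmetrizer q (partialD q y t) := by
  have : strip y ∘ₗ symmetrizer q = symmetrizer q ∘ₗ partialD q y := by
    refine ext_words fun w => ?_
    have hw : word 𝕜 w ∈ wordsLen 𝕜 X w.length := Submodule.subset_span ⟨w, rfl, rfl⟩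
    cases w with
    | nil => simp [symmetrizer, partialD, comulOne, braidProd, redWord]
    | cons x u =>
      simp only [LinearMap.comp_apply, partialD, comulOne, onWords_word]
      rw [symmetrizer_of_len q _ _ hw, map_sum, map_sum, map_sum]
      have hk : ∀ k : Fin (x :: u).length,
          symmetrizer q (strip y (braidProd q (List.range k) (word 𝕜 (x :: u))))
          = ∑ s : Equiv.Perm (Fin u.length),
            braidProd q (redWord u.length s)
              (strip y (braidProd q (List.range k) (word 𝕜 (x :: u)))) := fun k =>
        symmetrizer_of_len q _ _ (strip_mem y _ _ (braidProd_mem q _ _ _ hw))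
      simp only [hk]
      rw [← Fintype.sum_prod_type' (f := fun (k : Fin (x :: u).length)
        (s : Equiv.Perm (Fin u.length)) => braidProd q (redWord u.length s)
              (strip y (braidProd q (List.range k) (word 𝕜 (x :: u)))))]
      refine Fintype.sum_equiv (permSplit u.length) _ _ fun s => ?_
      change strip y (braidProd q (redWord (u.length + 1) s) _) = _
      rw [redWord, braidProd_append, Module.End.mul_apply,
        strip_braidProd_succ q _ y u.length _ (braidProd_mem q _ _ _ hw)]
  exact LinearMap.congr_fun this t

open Classical in
lemma partialD_consL (x y : X) (t : TensorAlg 𝕜 X) :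
    partialD q y (consL x t) = (if x = y then t else 0)
      + (q x (x ◃⁻¹ y) : 𝕜) • consL x (partialD q (x ◃⁻¹ y) t) := by
  have : partialD q y ∘ₗ consL x = (if x = y then LinearMap.id else 0)
      + (q x (x ◃⁻¹ y) : 𝕜) • (consL x ∘ₗ partialD q (x ◃⁻¹ y)) := by
    refine ext_words fun w => ?_
    simp only [LinearMap.comp_apply, consL_word, partialD, comulOne, onWords_word,
      LinearMap.add_apply, LinearMap.smul_apply, map_sum, Finset.smul_sum]
    rw [← consL_word, List.length_cons, Fin.sum_univ_succ]
    congr 1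
    · rw [Fin.val_zero, List.range_zero]
      simp only [braidProd, List.map_nil, List.prod_nil, Module.End.one_apply]
      rw [strip_consL]
      by_cases h : x = y <;> simp [h]
    · refine Finset.sum_congr rfl fun k _ => ?_
      rw [Fin.val_succ, List.range_succ_eq_map, ← braid_zero_consL]
      rw [← braidProd_map_succ]
      simp [braidProd]
  have := LinearMap.congr_fun this t
  by_cases h : x = y <;> simpa [h] using this

lemma partialD_nil (y : X) : partialD q y (word 𝕜 []) = 0 := by
  simp [partialD, comulOne]

lemma eps_eq_zero_of_mem {t : TensorAlg 𝕜 X} (h : symmetrizer q t = 0) : eps t = 0 := by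
  rw [← eps_symmetrizer q, h, map_zero]

lemma partialD_mem {t : TensorAlg 𝕜 X} (h : symmetrizer q t = 0) (y : X) :
    symmetrizer q (partialD q y t) = 0 := by
  rw [← strip_symmetrizer, h, map_zero]

lemma mem_of_partialD {t : TensorAlg 𝕜 X} (h0 : eps t = 0)
    (h : ∀ y, symmetrizer q (partialD q y t) = 0) : symmetrizer q t = 0 :=
  eq_zero_of_strip (by rw [eps_symmetrizer, h0]) fun y => by rw [strip_symmetrizer, h]

lemma partialD_mem_LE (y : X) (n : ℕ) (t : TensorAlg 𝕜 X) (ht : t ∈ wordsLE 𝕜 X (n + 1)) :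
    partialD q y t ∈ wordsLE 𝕜 X n := by
  classical
  induction ht using Submodule.span_induction with
  | mem t ht =>
    obtain ⟨w, hw, rfl⟩ := ht
    induction w generalizing y n with
    | nil => rw [partialD_nil]; exact Submodule.zero_mem _
    | cons x u ih =>
      rw [← consL_word, partialD_consL]
      refine Submodule.add_mem _ ?_ (Submodule.smul_mem _ _ ?_)
      · by_cases h : x = y
        · rw [if_pos h]
          exact Submodule.subset_span ⟨u, by simpa using hw, rfl⟩
        · rw [if_neg h]; exact Submodule.zero_mem _
      · cases n with
        | zero =>
          have : u = [] := by simpa using hw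
          subst this
          rw [partialD_nil, map_zero]; exact Submodule.zero_mem _
        | succ n => exact consL_mem_LE _ _ _ (ih _ _ (by simpa using hw))
  | zero => simp
  | add a b _ _ ha hb => simpa using Submodule.add_mem _ ha hb
  | smul c a _ ha => simpa using Submodule.smul_mem _ c ha


lemma consL_mem_ker (x : X) (n : ℕ) : ∀ t ∈ wordsLE 𝕜 X n, symmetrizer q t = 0 →
    symmetrizer q (consL x t) = 0 := by
  classical
  induction n generalizing x with
  | zero =>
    intro t ht h
    rw [eq_zero_of_LE_zero t ht (eps_eq_zero_of_mem q h)]; simp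
  | succ n ih =>
    intro t ht h
    refine mem_of_partialD q (eps_consL x t) fun y => ?_
    rw [partialD_consL, map_add, map_smul,
      ih _ _ (partialD_mem_LE q _ _ _ ht) (partialD_mem q h _), smul_zero, add_zero]
    by_cases hxy : x = y <;> simp [hxy, h]

open Classical in
/-- The coefficient of the letter `y` in `g_u · x`, where `g_u` is the degree of a word `u`. -/
def actCoeff (x y : X) : List X → 𝕜
  | [] => if x = y then 1 else 0
  | z :: w => (q z (z ◃⁻¹ y) : 𝕜) * actCoeff x (z ◃⁻¹ y) w

/-- The word `w` is multiplied by the coefficient of `y` in `w · x`. -/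
def actMul (x y : X) : Module.End 𝕜 (TensorAlg 𝕜 X) :=
  onWords fun w => actCoeff q x y w • word 𝕜 w

lemma actMul_consL (x y z : X) (t : TensorAlg 𝕜 X) :
    actMul q x y (consL z t) = (q z (z ◃⁻¹ y) : 𝕜) • consL z (actMul q x (z ◃⁻¹ y) t) := by
  have : actMul q x y ∘ₗ consL z
      = (q z (z ◃⁻¹ y) : 𝕜) • (consL z ∘ₗ actMul q x (z ◃⁻¹ y)) := by
    refine ext_words fun w => ?_
    simp [actMul, actCoeff, smul_smul]
  exact LinearMap.congr_fun this t

lemma cocycle_coe (x y z : X) : (q (x ◃ y) (x ◃ z) : 𝕜) * q x z = q x (y ◃ z) * q y z := by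
  exact_mod_cast congrArg Units.val (q.cocycle x y z)

lemma partialD_actMul (x y z : X) (t : TensorAlg 𝕜 X) :
    partialD q z (actMul q x y t)
      = (q z (z ◃⁻¹ y) : 𝕜) • actMul q x (z ◃⁻¹ y) (partialD q z t) := by
  classical
  have : ∀ w : List X, ∀ y z : X, partialD q z (actMul q x y (word 𝕜 w))
      = (q z (z ◃⁻¹ y) : 𝕜) • actMul q x (z ◃⁻¹ y) (partialD q z (word 𝕜 w)) := by
    intro w
    induction w with
    | nil => intro y z; simp [actMul, partialD_nil]
    | cons u w ih =>
      intro y z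
      rw [← consL_word, actMul_consL, map_smul, partialD_consL, partialD_consL, ih,
        map_add, map_smul, map_smul, actMul_consL, smul_add, smul_add]
      congr 1
      · by_cases h : u = z <;> simp [h]
      · have h1 : (u ◃⁻¹ z) ◃⁻¹ (u ◃⁻¹ y) = u ◃⁻¹ z ◃⁻¹ y := Rack.self_distrib_inv.symm
        rw [h1]
        simp only [smul_smul]
        congr 1
        have h2 := cocycle_coe q u (u ◃⁻¹ z) (u ◃⁻¹ z ◃⁻¹ y)
        have h3 : (u ◃⁻¹ z) ◃ (u ◃⁻¹ z ◃⁻¹ y) = u ◃⁻¹ y := by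
          rw [Rack.self_distrib_inv, Rack.act_invAct_eq]
        rw [Rack.act_invAct_eq, Rack.act_invAct_eq, h3] at h2
        linear_combination (-(q u (u ◃⁻¹ z) : 𝕜)) * h2
  have h : partialD q z ∘ₗ actMul q x y
      = (q z (z ◃⁻¹ y) : 𝕜) • (actMul q x (z ◃⁻¹ y) ∘ₗ partialD q z) :=
    ext_words fun w => this w y z
  exact LinearMap.congr_fun h t

lemma eps_actMul (x y : X) (t : TensorAlg 𝕜 X) (h : eps t = 0) : eps (actMul q x y t) = 0 := by
  have : eps ∘ₗ actMul q x y = actCoeff q x y [] • eps := by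
    refine ext_words fun w => ?_
    cases w with
    | nil => simp [actMul]
    | cons z u =>
      rw [LinearMap.comp_apply, LinearMap.smul_apply, ← consL_word, actMul_consL, map_smul,
        eps_consL, eps_consL, smul_zero, smul_zero]
  have := LinearMap.congr_fun this t
  simpa [h] using this

lemma actMul_mem_ker (x : X) (n : ℕ) : ∀ y, ∀ t ∈ wordsLE 𝕜 X n, symmetrizer q t = 0 →
    symmetrizer q (actMul q x y t) = 0 := by
  induction n with
  | zero =>
    intro y t ht h
    rw [eq_zero_of_LE_zero t ht (eps_eq_zero_of_mem q h)]; simp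
  | succ n ih =>
    intro y t ht h
    refine mem_of_partialD q (eps_actMul q x y t (eps_eq_zero_of_mem q h)) fun z => ?_
    rw [partialD_actMul, map_smul,
      ih _ _ (partialD_mem_LE q _ _ _ ht) (partialD_mem q h _), smul_zero]

lemma partialD_mulLetter (x y : X) (t : TensorAlg 𝕜 X) :
    partialD q y (t * word 𝕜 [x]) = partialD q y t * word 𝕜 [x] + actMul q x y t := by
  classical
  have : ∀ w : List X, ∀ y : X, partialD q y (word 𝕜 w * word 𝕜 [x])
      = partialD q y (word 𝕜 w) * word 𝕜 [x] + actMul q x y (word 𝕜 w) := by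
    intro w
    induction w with
    | nil =>
      intro y
      rw [word_mul, List.nil_append, ← consL_word, partialD_consL, partialD_nil]
      by_cases h : x = y <;> simp [h, actMul, actCoeff, partialD_nil]
    | cons z w ih =>
      intro y
      rw [← consL_word, ← consL_mul, partialD_consL, partialD_consL, ih, actMul_consL, map_add,
        smul_add, add_mul, consL_mul, smul_mul_assoc, ← add_assoc]
      by_cases h : z = y <;> simp [h]
  have h : partialD q y ∘ₗ LinearMap.mulRight 𝕜 (word 𝕜 [x])
      = LinearMap.mulRight 𝕜 (word 𝕜 [x]) ∘ₗ partialD q y + actMul q x y :=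
    ext_words fun w => this w y
  exact LinearMap.congr_fun h t

lemma mulLetter_mem_ker (x : X) (n : ℕ) : ∀ t ∈ wordsLE 𝕜 X n, symmetrizer q t = 0 →
    symmetrizer q (t * word 𝕜 [x]) = 0 := by
  induction n with
  | zero =>
    intro t ht h
    rw [eq_zero_of_LE_zero t ht (eps_eq_zero_of_mem q h)]; simp
  | succ n ih =>
    intro t ht h
    refine mem_of_partialD q (eps_mulLetter x t) fun y => ?_
    rw [partialD_mulLetter, map_add, actMul_mem_ker q x _ y t ht h,
      ih _ (partialD_mem_LE q _ _ _ ht) (partialD_mem q h _), add_zero]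

lemma mul_mem_ker_left (s t : TensorAlg 𝕜 X) (h : symmetrizer q t = 0) :
    symmetrizer q (s * t) = 0 := by
  have : symmetrizer q ∘ₗ LinearMap.mulRight 𝕜 t = 0 := by
    refine ext_words fun w => ?_
    rw [LinearMap.comp_apply, LinearMap.mulRight_apply, LinearMap.zero_apply]
    induction w with
    | nil => simpa [word_nil] using h
    | cons x w ih =>
      obtain ⟨n, hn⟩ := exists_mem_wordsLE (word 𝕜 w * t)
      rw [← consL_word, ← consL_mul]
      exact consL_mem_ker q x n _ hn ih
  exact LinearMap.congr_fun this s

lemma mul_mem_ker_right (s t : TensorAlg 𝕜 X) (h : symmetrizer q s = 0) :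
    symmetrizer q (s * t) = 0 := by
  have : symmetrizer q ∘ₗ LinearMap.mulLeft 𝕜 s = 0 := by
    refine ext_words fun w => ?_
    rw [LinearMap.comp_apply, LinearMap.mulLeft_apply, LinearMap.zero_apply]
    induction w generalizing s with
    | nil => simpa [word_nil] using h
    | cons x w ih =>
      obtain ⟨n, hn⟩ := exists_mem_wordsLE s
      rw [word_cons, ← mul_assoc]
      exact ih _ (mulLetter_mem_ker q x n s hn h)
  exact LinearMap.congr_fun this t

/-! ### The Nichols algebra -/

/-- The two-sided ideal `⨁ ker Sₙ`, the kernel of all `Sₙ` together (the symmetrizer respects the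
degree, and `S₀` and `S₁` are identities). -/
def nicholsIdeal : Ideal (TensorAlg 𝕜 X) where
  carrier := {t | symmetrizer q t = 0}
  add_mem' {a b} ha hb := by
    have ha' : symmetrizer q a = 0 := ha
    have hb' : symmetrizer q b = 0 := hb
    simp [ha', hb']
  zero_mem' := by simp
  smul_mem' s t ht := mul_mem_ker_left q s t ht

instance : (nicholsIdeal q).IsTwoSided := ⟨fun {a} b ha => mul_mem_ker_right q a b ha⟩

/-- The Nichols algebra `B(V) = ⨁ T(V)(n) / ker Sₙ` of the braided vector space `(𝕜X, c_q)`. -/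
abbrev NicholsAlgebra := TensorAlg 𝕜 X ⧸ nicholsIdeal q

/-- The canonical map `μ` from the tensor algebra to the Nichols algebra. -/
def toNichols : TensorAlg 𝕜 X →ₐ[𝕜] NicholsAlgebra q := Ideal.Quotient.mkₐ 𝕜 (nicholsIdeal q)

/-! ### The comultiplication of the Nichols algebra -/

lemma actT_consL (x y : X) (t : TensorAlg 𝕜 X) :
    actT q x (consL y t) = (q x y : 𝕜) • consL (x ◃ y) (actT q x t) := by
  have : actT q x (word 𝕜 [y]) = (q x y : 𝕜) • word 𝕜 [x ◃ y] := by
    simp [actT, word]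
  simp only [consL, LinearMap.mulLeft_apply, map_mul, this, smul_mul_assoc]

lemma partialD_actT (x z : X) (t : TensorAlg 𝕜 X) :
    partialD q (x ◃ z) (actT q x t) = (q x z : 𝕜) • actT q x (partialD q z t) := by
  classical
  have : ∀ w : List X, ∀ z : X, partialD q (x ◃ z) (actT q x (word 𝕜 w))
      = (q x z : 𝕜) • actT q x (partialD q z (word 𝕜 w)) := by
    intro w
    induction w with
    | nil => intro z; rw [word_nil, map_one, ← word_nil, partialD_nil, partialD_nil]; simp
    | cons u w ih =>
      intro z
      have h1 : (x ◃ u) ◃⁻¹ (x ◃ z) = x ◃ (u ◃⁻¹ z) := by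
        rw [← Rack.left_cancel (x ◃ u), Rack.act_invAct_eq, ← Shelf.self_distrib,
          Rack.act_invAct_eq]
      rw [← consL_word, actT_consL, map_smul, partialD_consL, partialD_consL, h1, ih,
        map_add, map_smul, map_smul, actT_consL, smul_add, smul_add]
      congr 1
      · by_cases h : u = z <;> simp [h, Rack.left_cancel]
      · simp only [smul_smul]
        congr 1
        have h2 := cocycle_coe q x u (u ◃⁻¹ z)
        rw [Rack.act_invAct_eq] at h2
        linear_combination (q x u : 𝕜) * h2
  have h : partialD q (x ◃ z) ∘ₗ (actT q x).toLinearMap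
      = (q x z : 𝕜) • ((actT q x).toLinearMap ∘ₗ partialD q z) :=
    ext_words fun w => this w z
  exact LinearMap.congr_fun h t

lemma comulT_consL (x : X) (t : TensorAlg 𝕜 X) :
    comulT q (consL x t) = coprodLetter q x (comulT q t) := by
  have : comulT q ∘ₗ consL x = coprodLetter q x ∘ₗ comulT q :=
    ext_words fun w => by simp [comulT]
  exact LinearMap.congr_fun this t

lemma comulT_nil : comulT q (word 𝕜 []) = 1 ⊗ₜ 1 := by simp [comulT]

lemma eps_comulT (t : TensorAlg 𝕜 X) :
    LinearMap.rTensor (TensorAlg 𝕜 X) eps (comulT q t) = 1 ⊗ₜ t := by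
  have h0 : ∀ x : X, ∀ z : TensorAlg 𝕜 X ⊗[𝕜] TensorAlg 𝕜 X,
      LinearMap.rTensor (TensorAlg 𝕜 X) eps (coprodLetter q x z)
        = LinearMap.lTensor 𝕜 (consL x) (LinearMap.rTensor (TensorAlg 𝕜 X) eps z) := by
    intro x z
    have heps : ∀ t : TensorAlg 𝕜 X, eps (actT q x t) = eps t := by
      intro t
      have : eps ∘ₗ (actT q x).toLinearMap = eps := by
        refine ext_words fun w => ?_
        cases w with
        | nil => simp [word_nil]
        | cons y u =>
          rw [← consL_word, LinearMap.comp_apply, AlgHom.toLinearMap_apply, actT_consL, map_smul,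
            eps_consL, eps_consL, smul_zero]
      exact LinearMap.congr_fun this t
    induction z using TensorProduct.induction_on with
    | zero => simp
    | tmul a b => simp [coprodLetter, heps]
    | add a b ha hb => simp only [map_add, ha, hb]
  have : LinearMap.rTensor (TensorAlg 𝕜 X) eps ∘ₗ comulT q
      = TensorProduct.mk 𝕜 𝕜 (TensorAlg 𝕜 X) 1 := by
    refine ext_words fun w => ?_
    simp only [LinearMap.comp_apply, TensorProduct.mk_apply]
    induction w with
    | nil => rw [comulT_nil, ← word_nil]; simp
    | cons x w ih => rw [← consL_word, comulT_consL, h0, ih]; simp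
  exact LinearMap.congr_fun this t

lemma partialD_comulT (y : X) (t : TensorAlg 𝕜 X) :
    LinearMap.rTensor (TensorAlg 𝕜 X) (partialD q y) (comulT q t)
      = comulT q (partialD q y t) := by
  classical
  have h0 : ∀ x y : X, ∀ z : TensorAlg 𝕜 X ⊗[𝕜] TensorAlg 𝕜 X,
      LinearMap.rTensor (TensorAlg 𝕜 X) (partialD q y) (coprodLetter q x z)
        = (if x = y then z else 0) + (q x (x ◃⁻¹ y) : 𝕜) •
          coprodLetter q x (LinearMap.rTensor (TensorAlg 𝕜 X) (partialD q (x ◃⁻¹ y)) z) := by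
    intro x y z
    induction z using TensorProduct.induction_on with
    | zero => simp
    | tmul a b =>
      have h1 := partialD_actT q x (x ◃⁻¹ y) a
      rw [Rack.act_invAct_eq] at h1
      simp only [coprodLetter, LinearMap.add_apply, TensorProduct.map_tmul, LinearMap.id_coe, id,
        AlgHom.toLinearMap_apply, map_add, LinearMap.rTensor_tmul, partialD_consL, h1,
        TensorProduct.add_tmul, smul_add, TensorProduct.smul_tmul', add_assoc]
      congr 1
      by_cases h : x = y <;> simp [h]
    | add a b ha hb =>
      simp only [map_add, ha, hb, smul_add]
      by_cases h : x = y
      · simp only [h, if_true]; abel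
      · simp only [h, if_false]; abel
  have : ∀ w : List X, ∀ y : X,
      LinearMap.rTensor (TensorAlg 𝕜 X) (partialD q y) (comulT q (word 𝕜 w))
      = comulT q (partialD q y (word 𝕜 w)) := by
    intro w
    induction w with
    | nil => intro y; rw [comulT_nil, partialD_nil, ← word_nil]; simp [partialD_nil]
    | cons x w ih =>
      intro y
      rw [← consL_word, comulT_consL, h0, ih, partialD_consL, map_add, map_smul, comulT_consL]
      by_cases h : x = y <;> simp [h]
  have h : LinearMap.rTensor (TensorAlg 𝕜 X) (partialD q y) ∘ₗ comulT q
      = comulT q ∘ₗ partialD q y := ext_words fun w => this w y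
  exact LinearMap.congr_fun h t

lemma symmetrizer_comulT (n : ℕ) : ∀ t ∈ wordsLE 𝕜 X n, symmetrizer q t = 0 →
    TensorProduct.map (symmetrizer q) (symmetrizer q) (comulT q t) = 0 := by
  induction n with
  | zero =>
    intro t ht h
    rw [eq_zero_of_LE_zero t ht (eps_eq_zero_of_mem q h)]; simp
  | succ n ih =>
    intro t ht h
    apply tensor_eq_zero
    · have : LinearMap.rTensor (TensorAlg 𝕜 X) eps
          ∘ₗ TensorProduct.map (symmetrizer q) (symmetrizer q)
          = LinearMap.lTensor 𝕜 (symmetrizer q) ∘ₗ LinearMap.rTensor (TensorAlg 𝕜 X) eps := by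
        apply TensorProduct.ext'
        intro a b
        simp [eps_symmetrizer]
      have := LinearMap.congr_fun this (comulT q t)
      rw [LinearMap.comp_apply, LinearMap.comp_apply, eps_comulT] at this
      rw [this]; simp [h]
    · intro y
      have : LinearMap.rTensor (TensorAlg 𝕜 X) (strip y)
          ∘ₗ TensorProduct.map (symmetrizer q) (symmetrizer q)
          = TensorProduct.map (symmetrizer q) (symmetrizer q)
            ∘ₗ LinearMap.rTensor (TensorAlg 𝕜 X) (partialD q y) := by
        apply TensorProduct.ext'
        intro a b
        simp [strip_symmetrizer]
      have := LinearMap.congr_fun this (comulT q t)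
      rw [LinearMap.comp_apply, LinearMap.comp_apply, partialD_comulT] at this
      rw [this]
      exact ih _ (partialD_mem_LE q _ _ _ ht) (partialD_mem q h _)

lemma comulT_mem_ker (t : TensorAlg 𝕜 X) (h : symmetrizer q t = 0) :
    TensorProduct.map (toNichols q).toLinearMap (toNichols q).toLinearMap (comulT q t) = 0 := by
  obtain ⟨n, hn⟩ := exists_mem_wordsLE t
  have h1 := symmetrizer_comulT q n t hn h
  let e : NicholsAlgebra q →ₗ[𝕜] TensorAlg 𝕜 X :=
    ((nicholsIdeal q).restrictScalars 𝕜).liftQ (symmetrizer q) (fun _ ht => ht) ∘ₗ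
      (Submodule.Quotient.restrictScalarsEquiv 𝕜 (nicholsIdeal q)).symm.toLinearMap
  have he : ∀ t, e (toNichols q t) = symmetrizer q t := fun t => rfl
  have hinj : Function.Injective e := by
    rw [injective_iff_map_eq_zero]
    intro b hb
    obtain ⟨t, rfl⟩ := Ideal.Quotient.mk_surjective b
    exact Ideal.Quotient.eq_zero_iff_mem.2 ((he t).symm.trans hb)
  have h2 : TensorProduct.map e e ∘ₗ
      TensorProduct.map (toNichols q).toLinearMap (toNichols q).toLinearMap
      = TensorProduct.map (symmetrizer q) (symmetrizer q) := by
    apply TensorProduct.ext'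
    intro a b
    simp [he]
  have h3 := LinearMap.congr_fun h2 (comulT q t)
  rw [h1, LinearMap.comp_apply] at h3
  have h4 : Function.Injective (TensorProduct.map e e) := by
    rw [← LinearMap.lTensor_comp_rTensor]
    exact (Module.Flat.lTensor_preserves_injective_linearMap e hinj).comp
      (Module.Flat.rTensor_preserves_injective_linearMap e hinj)
  exact h4 (by rw [h3, map_zero])

/-- The comultiplication of the Nichols algebra, induced by that of the tensor algebra. -/
def comul : NicholsAlgebra q →ₗ[𝕜] NicholsAlgebra q ⊗[𝕜] NicholsAlgebra q :=
  ((nicholsIdeal q).restrictScalars 𝕜).liftQ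
      (TensorProduct.map (toNichols q).toLinearMap (toNichols q).toLinearMap ∘ₗ comulT q)
      (fun t ht => comulT_mem_ker q t ht) ∘ₗ
    (Submodule.Quotient.restrictScalarsEquiv 𝕜 (nicholsIdeal q)).symm.toLinearMap

lemma comul_toNichols (t : TensorAlg 𝕜 X) : comul q (toNichols q t)
    = TensorProduct.map (toNichols q).toLinearMap (toNichols q).toLinearMap (comulT q t) := rfl

/-! ### Left coideal subalgebras -/

/-- The generator `v_x` of the Nichols algebra. -/
def gen (x : X) : NicholsAlgebra q := toNichols q (word 𝕜 [x])

/-- The homogeneous component `B(V)(n)` of the `ℕ`-grading. -/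
def degreePart (n : ℕ) : Submodule 𝕜 (NicholsAlgebra q) :=
  (wordsLen 𝕜 X n).map (toNichols q).toLinearMap

/-- The degree `g_{x₁} ⋯ g_{xₙ}` of a word in the enveloping group of the rack `X`. -/
def envelDegree (w : List X) : Rack.EnvelGroup X :=
  (w.map fun x => (Rack.toEnvelGroup X x : Rack.EnvelGroup X)).prod

/-- The homogeneous component of degree `g` of the grading of `B(V)` by the enveloping group `G_X`,
which is its coaction of the group algebra of `G_X`. -/
def groupPart (g : Rack.EnvelGroup X) : Submodule 𝕜 (NicholsAlgebra q) :=
  (Submodule.span 𝕜 {t | ∃ w : List X, envelDegree w = g ∧ t = word 𝕜 w}).map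
    (toNichols q).toLinearMap

/-- `C` is a left coideal subalgebra of `B(V)` in the category of `ℕ`-graded comodules over the group
algebra of the enveloping group `G_X`. Comodules over a group algebra are vector spaces graded by the
group, and their subcomodules are the graded subspaces. -/
structure IsGradedLeftCoidealSubalgebra (C : Subalgebra 𝕜 (NicholsAlgebra q)) : Prop where
  comul_mem : ∀ x ∈ C, comul q x ∈
    LinearMap.range (LinearMap.lTensor (NicholsAlgebra q) C.val.toLinearMap)
  graded : Subalgebra.toSubmodule C = ⨆ n, Subalgebra.toSubmodule C ⊓ degreePart q n
  subcomodule : Subalgebra.toSubmodule C = ⨆ g, Subalgebra.toSubmodule C ⊓ groupPart q g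

/-- `C` is generated as an algebra by its component `C(1)` of degree one. -/
def GeneratedInDegreeOne (C : Subalgebra 𝕜 (NicholsAlgebra q)) : Prop :=
  C = Algebra.adjoin 𝕜 {x | x ∈ C ∧ x ∈ degreePart q 1}

/-- The Nichols algebra is slim in degree two. -/
def SlimInDegreeTwo : Prop :=
  (∀ a b : X, a ◃ b = b → b ≠ a →
    toNichols q ((1 - braid q 0 : Module.End 𝕜 (TensorAlg 𝕜 X)) (word 𝕜 [a, b])) = 0) ∧
  (∀ a b : X, a ◃ b ≠ b →
    toNichols q ((1 - braid q 0 + braid q 0 ^ 2 : Module.End 𝕜 (TensorAlg 𝕜 X)) (word 𝕜 [a, b])) = 0)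

/-- `Z(a,b,c,d) = μ(id - c₁c₂c₃ + (c₁c₂c₃)² - (c₁c₂c₃)³)(v_a ⊗ v_b ⊗ v_c ⊗ v_d)`. -/
def elementZ (a b c d : X) : NicholsAlgebra q :=
  toNichols q ((1 - braid q 0 * braid q 1 * braid q 2
    + (braid q 0 * braid q 1 * braid q 2) ^ 2
    - (braid q 0 * braid q 1 * braid q 2) ^ 3 : Module.End 𝕜 (TensorAlg 𝕜 X)) (word 𝕜 [a, b, c, d]))

/-- A braided rack. -/
def IsBraidedRack (X : Type*) [Rack X] : Prop :=
  (∀ x : X, x ◃ x = x) ∧ ∀ x y : X, x ◃ y = y ∨ x ◃ (y ◃ x) = y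

/-- `x □ y`: the elements `x` and `y` are distinct and commute. -/
def CommuteDistinct {X : Type*} [Rack X] (x y : X) : Prop := x ◃ y = y ∧ x ≠ y

/-- The map `j` identifies the rack `X` with a union of conjugacy classes of the group `G`, with
operation `x ◃ y = x y x⁻¹`. -/
def IsUnionOfConjClasses {X : Type*} [Rack X] {G : Type*} [Group G]
    (j : X →◃ Quandle.Conj G) : Prop :=
  Function.Injective j ∧ ∀ (g : G) (x : X), ∃ y : X, (j y : G) = g * j x * g⁻¹

end RackNichols

end

noncomputable section

namespace RackNichols

/-! ### Commuting and noncommuting pairs in a braided rack -/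

section Braided

variable {X : Type*} [Rack X]

/-! In a braided rack two noncommuting elements lie in a cyclically permuted triple. With the three
prescribed commuting pairs this determines every product needed: `IsBraidedRack.config` collects the
relations among a, b, c, d and the eight elements derived from them. In particular e = a ▷ m with m
= c ▷ d, f = b ▷ d and g = a ▷ d.

Left coideal. A subalgebra stable under all skew derivations ∂_y is a left coideal
(`comul_mem_of_partialD`). It suffices to test this on generators that satisfy a Leibniz rule
(`partialD_mem_adjoin`). The tensor of Z is a combination of the words abcd, eabc, feab, gfea, each
obtained from the preceding one by moving its last letter to the front through the braiding. All
four therefore have the same degree in the enveloping group, which makes Z homogeneous and gives it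
a Leibniz rule like that of a single word (`leibniz_tensorZ`). The derivatives of Z are computed in
`Config.partialD_tensorZ`. Of the sixteen terms, those at y = e, f, g cancel in pairs. Those at a,
m, p, k are products of generating letters. At b' = a ▷ b and h = a ▷ b ▷ c, the relations in degree
two turn v_a v_c v_d and v_a v_b v_d into v_c v_d v_g and v_d v_g v_f plus terms that cancel. The
scalars agree by the cocycle condition and the identities for q forced by slimness.

Generation. Z has degree four, so C(1) is spanned by the six letters
(`mem_map_wordsIn_of_degree_one`). If C(1) generated C, then Z would be represented by a combination
of words in b, c, d, e, f, g. The coefficient of abcd in the image of the braided symmetrizer is a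
functional on the Nichols algebra. It vanishes on all such words (`Config.symCoeff_wordsIn`) because
each letter whose deletion could contribute lies outside the six. Its value on Z is 1
(`Config.symCoeff_tensorZ`), unless gfe and bcd are the same word. -/

/-- `x`, `y`, `z` are pairwise noncommuting and are cyclically permuted by the rack operation. -/
structure IsTriangle (x y z : X) : Prop where
  xy : x ◃ y = z
  yz : y ◃ z = x
  zx : z ◃ x = y
  ne : x ≠ y
  ne' : y ≠ z
  ne'' : x ≠ z

lemma IsBraidedRack.comm_symm (hX : IsBraidedRack X) {x y : X} (h : x ◃ y = y) : y ◃ x = x := by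
  rcases hX.2 y x with h1 | h1
  · exact h1
  · rw [h, hX.1] at h1; rw [h1, hX.1]

/-- Two of the three products are the braided condition for (x, y) and (y, x). The third follows
from x ▷ (y ▷ x) = (x ▷ y) ▷ (x ▷ x). -/
lemma IsBraidedRack.triangle (hX : IsBraidedRack X) {x y : X} (h : x ◃ y ≠ y) :
    IsTriangle x y (x ◃ y) := by
  have h1 : x ◃ (y ◃ x) = y := (hX.2 x y).resolve_left h
  have h2 : y ◃ x ≠ x := fun h' => h (hX.comm_symm h')
  have h3 : y ◃ (x ◃ y) = x := (hX.2 y x).resolve_left h2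
  refine ⟨rfl, h3, ?_, ?_, h.symm, ?_⟩
  · have := Shelf.self_distrib (x := x) (y := y) (z := x)
    rw [hX.1 x, h1] at this
    exact this.symm
  · rintro rfl; exact h (hX.1 _)
  · intro h'; exact h2 (by rw [← h'] at h3; exact h3)

lemma IsTriangle.noncomm {x y z : X} (h : IsTriangle x y z) : x ◃ y ≠ y := by
  rw [h.xy]; exact h.ne'.symm

lemma IsTriangle.rotate {x y z : X} (h : IsTriangle x y z) : IsTriangle y z x :=
  ⟨h.yz, h.zx, h.xy, h.ne', h.ne''.symm, h.ne.symm⟩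

lemma IsTriangle.act {x y z : X} (h : IsTriangle x y z) (u : X) :
    IsTriangle (u ◃ x) (u ◃ y) (u ◃ z) := by
  refine ⟨?_, ?_, ?_, ?_, ?_, ?_⟩
  · rw [← Shelf.self_distrib, h.xy]
  · rw [← Shelf.self_distrib, h.yz]
  · rw [← Shelf.self_distrib, h.zx]
  · simpa [Rack.left_cancel] using h.ne
  · simpa [Rack.left_cancel] using h.ne'
  · simpa [Rack.left_cancel] using h.ne''

lemma act_comm {x y : X} (h : x ◃ y = y) (u : X) : (u ◃ x) ◃ (u ◃ y) = u ◃ y := by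
  rw [← Shelf.self_distrib, h]

lemma act_act_of_comm {x y : X} (h : x ◃ y = y) (z : X) : x ◃ (y ◃ z) = y ◃ (x ◃ z) := by
  rw [Shelf.self_distrib, h]

lemma invAct_eq {x y z : X} (h : x ◃ y = z) : x ◃⁻¹ z = y := by
  rw [← h, Rack.invAct_act_eq]

/-- The relations between the elements `a`, `b`, `c`, `d` and the further elements obtained from
them: `e = a ◃ m`, `f = b ◃ d`, `g = a ◃ d`, `m = c ◃ d`, `p = b ◃ c`, `b' = a ◃ b`, `h = a ◃ p`
and `k = g ◃ p`. -/
structure Config (a b c d e f g m p b' h k : X) : Prop where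
  cdm : IsTriangle c d m
  bdf : IsTriangle b d f
  adg : IsTriangle a d g
  abb' : IsTriangle a b b'
  bcp : IsTriangle b c p
  ame : IsTriangle a m e
  cge : IsTriangle c g e
  fmp : IsTriangle f m p
  feh : IsTriangle f e h
  gfb' : IsTriangle g f b'
  b'ch : IsTriangle b' c h
  aph : IsTriangle a p h
  gpk : IsTriangle g p k
  dkh : IsTriangle d k h
  ac : a ◃ c = c
  af : a ◃ f = f
  bm : b ◃ m = m
  eb' : e ◃ b' = b'
  dp : d ◃ p = p
  gh : g ◃ h = h
  pe : e ◃ p = p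
  ck : c ◃ k = k
  ac_ne : a ≠ c
  af_ne : a ≠ f
  bm_ne : b ≠ m

/-- Left translations are rack automorphisms, so they carry commuting pairs to commuting pairs and
triangles to triangles. Each new relation is the image of an earlier one under a translation whose
values on that relation are already known. -/
theorem IsBraidedRack.config (hX : IsBraidedRack X) {a b c d : X}
    (hab : a ◃ b ≠ b) (had : a ◃ d ≠ d) (hbc : b ◃ c ≠ c) (hbd : b ◃ d ≠ d) (hcd : c ◃ d ≠ d)
    (hac : CommuteDistinct a c) (hbcd : CommuteDistinct b (c ◃ d))
    (habd : CommuteDistinct a (b ◃ d)) :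
    Config a b c d (a ◃ c ◃ d) (b ◃ d) (a ◃ d) (c ◃ d) (b ◃ c) (a ◃ b) (a ◃ b ◃ c)
      ((a ◃ d) ◃ b ◃ c) := by
  obtain ⟨hac, hac'⟩ := hac
  obtain ⟨hbm, hbm'⟩ := hbcd
  obtain ⟨haf, haf'⟩ := habd
  have cdm := hX.triangle hcd
  have bdf := hX.triangle hbd
  have adg := hX.triangle had
  have abb' := hX.triangle hab
  have bcp := hX.triangle hbc
  have he : a ◃ c ◃ d = c ◃ a ◃ d := act_act_of_comm hac d
  have ame : IsTriangle a (c ◃ d) (a ◃ c ◃ d) := hX.triangle (by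
    rw [he, Ne, Rack.left_cancel]; exact had)
  have cge : IsTriangle c (a ◃ d) (a ◃ c ◃ d) := by
    have := cdm.act a
    rw [hac] at this
    exact this
  have fmp : IsTriangle (b ◃ d) (c ◃ d) (b ◃ c) := by
    have := cdm.rotate.act b
    rw [hbm] at this
    exact this
  have feh : IsTriangle (b ◃ d) (a ◃ c ◃ d) (a ◃ b ◃ c) := by
    have := fmp.act a
    rw [haf] at this
    exact this
  have gfb' : IsTriangle (a ◃ d) (b ◃ d) (a ◃ b) := by
    have := bdf.rotate.act a
    rw [haf] at this
    exact this
  have b'ch : IsTriangle (a ◃ b) c (a ◃ b ◃ c) := by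
    have := bcp.act a
    rw [hac] at this
    exact this
  have dp : d ◃ b ◃ c = b ◃ c := by
    have := act_comm hbm (b ◃ d)
    rwa [bdf.zx, fmp.xy] at this
  have aph : IsTriangle a (b ◃ c) (a ◃ b ◃ c) := hX.triangle (by
    have := b'ch.act b
    rw [abb'.yz] at this
    exact this.noncomm)
  have gh : (a ◃ d) ◃ a ◃ b ◃ c = a ◃ b ◃ c := act_comm dp a
  have gpk : IsTriangle (a ◃ d) (b ◃ c) ((a ◃ d) ◃ b ◃ c) := hX.triangle (by
    have := adg.rotate.rotate.act (a ◃ b ◃ c)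
    rw [hX.comm_symm gh, aph.zx] at this
    exact this.noncomm)
  have dk : d ◃ (a ◃ d) ◃ b ◃ c = a ◃ b ◃ c := by
    rw [Shelf.self_distrib, dp, adg.yz]
  have dkh : IsTriangle d ((a ◃ d) ◃ b ◃ c) (a ◃ b ◃ c) := by
    -- If d fixed k, then k = h and d would commute with h. Acting by p, which fixes d and sends h
    -- to a, would make d commute with a.
    have := hX.triangle (x := d) (y := (a ◃ d) ◃ b ◃ c) (by
      intro h
      have h1 : d ◃ a ◃ b ◃ c = a ◃ b ◃ c := by rw [← dk, h, h]
      have h2 := act_comm h1 (b ◃ c)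
      rw [hX.comm_symm dp, aph.yz] at h2
      exact had (hX.comm_symm h2))
    rwa [dk] at this
  have pe : (a ◃ c ◃ d) ◃ b ◃ c = b ◃ c := by
    have := act_comm (hX.comm_symm haf) (a ◃ b ◃ c)
    rwa [feh.zx, aph.zx] at this
  have ck : c ◃ (a ◃ d) ◃ b ◃ c = (a ◃ d) ◃ b ◃ c := by
    have := act_comm pe (a ◃ d)
    rwa [cge.yz] at this
  exact ⟨cdm, bdf, adg, abb', bcp, ame, cge, fmp, feh, gfb', b'ch, aph, gpk, dkh, hac, haf, hbm,
    act_comm (hX.comm_symm hbm) a, dp, gh, pe, ck, hac', haf', hbm'⟩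

/-! ### Products and inequalities in the configuration -/

namespace Config

variable {a b c d e f g m p b' h k : X}

/-- Translations are bijective, so an inequality can be moved forwards or backwards along one to a
pair already known to be distinct. -/
lemma ne_of_act {x y z w : X} (u : X) (hx : u ◃ x = z) (hy : u ◃ y = w) (h : z ≠ w) : x ≠ y := by
  rintro rfl; exact h (hx.symm.trans hy)

lemma act_ne {x y z w : X} (u : X) (hx : u ◃ x = z) (hy : u ◃ y = w) (h : x ≠ y) : z ≠ w := by
  rintro rfl; exact h ((Rack.left_cancel u).1 (hx.trans hy.symm))

/-- Both e and h are a-translates, so this is a ▷ (m ▷ b ▷ c). As m and b commute, it equals a ▷ b ▷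
(m ▷ c) = a ▷ b ▷ d = a ▷ f. It identifies eab ▷ c with b ▷ d. -/
lemma e_act_h (H : Config a b c d e f g m p b' h k) (hX : IsBraidedRack X) :
    e ◃ h = f := by
  rw [← H.ame.xy, ← H.aph.xy, ← Shelf.self_distrib, ← H.bcp.xy,
    act_act_of_comm (hX.comm_symm H.bm), H.cdm.zx, H.bdf.xy, H.af]

lemma f_act_b' (H : Config a b c d e f g m p b' h k) : f ◃ b' = g := H.gfb'.yz

/-- The elements a, m, p, b', h, k are the obstructions in the coefficient computation: a is the
first letter of abcd, and the others are the letters that would have to be deleted from a later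
position to reach bcd or abcd. -/
lemma not_mem_a (H : Config a b c d e f g m p b' h k) : a ∉ ({b, c, d, e, f, g} : Set X) := by
  simp [H.abb'.ne, H.ac_ne, H.adg.ne, H.ame.ne'', H.af_ne, H.adg.ne'']

lemma not_mem_m (H : Config a b c d e f g m p b' h k) : m ∉ ({b, c, d, e, f, g} : Set X) := by
  have hg : m ≠ g := ne_of_act d H.cdm.yz H.adg.yz H.ac_ne.symm
  simp [H.bm_ne.symm, H.cdm.ne''.symm, H.cdm.ne'.symm, H.ame.ne', H.fmp.ne.symm, hg]

lemma p_ne_d (H : Config a b c d e f g m p b' h k) : p ≠ d :=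
  act_ne f H.fmp.xy H.bdf.zx H.bm_ne.symm

lemma p_ne_e (H : Config a b c d e f g m p b' h k) : p ≠ e :=
  act_ne h H.aph.zx H.feh.zx H.af_ne

lemma not_mem_p (H : Config a b c d e f g m p b' h k) : p ∉ ({b, c, d, e, f, g} : Set X) := by
  have hg : p ≠ g := by
    rintro rfl; exact H.adg.ne'' (H.adg.yz.symm.trans H.dp)
  simp [H.bcp.ne''.symm, H.bcp.ne'.symm, H.p_ne_d, H.p_ne_e, H.fmp.ne''.symm, hg]

lemma not_mem_b' (H : Config a b c d e f g m p b' h k) : b' ∉ ({b, c, d, e, f, g} : Set X) := by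
  have hd : b' ≠ d := ne_of_act b H.abb'.yz H.bdf.xy H.af_ne
  have he : b' ≠ e := act_ne a H.abb'.xy H.ame.xy H.bm_ne
  simp [H.abb'.ne'.symm, H.b'ch.ne, hd, he, H.gfb'.ne'.symm, H.gfb'.ne''.symm]

lemma h_ne_b (H : Config a b c d e f g m p b' h k) : h ≠ b :=
  act_ne b' H.b'ch.xy H.abb'.zx H.ac_ne.symm

lemma not_mem_h (H : Config a b c d e f g m p b' h k) : h ∉ ({b, c, d, e, f, g} : Set X) := by
  have hg : h ≠ g := act_ne a H.aph.xy H.adg.xy H.p_ne_d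
  simp [H.h_ne_b, H.b'ch.ne'.symm, H.dkh.ne''.symm, H.feh.ne'.symm, H.feh.ne''.symm, hg]

lemma not_mem_k (H : Config a b c d e f g m p b' h k) : k ∉ ({b, c, d, e, f, g} : Set X) := by
  have hb : k ≠ b := by
    rintro rfl; exact H.bcp.ne'' ((Rack.left_cancel c).1 (H.ck.trans H.bcp.yz.symm))
  have hc : k ≠ c := act_ne g H.gpk.xy H.cge.yz H.p_ne_e
  have he : k ≠ e := by
    rintro rfl; exact H.cge.ne' ((Rack.left_cancel c).1 (H.cge.xy.trans H.ck.symm))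
  have hf : k ≠ f := ne_of_act d H.dkh.xy H.bdf.yz H.h_ne_b
  simp [hb, hc, H.dkh.ne.symm, he, hf, H.gpk.ne''.symm]

end Config

end Braided

end RackNichols
end

noncomputable section

namespace RackNichols

variable {𝕜 : Type*} {X : Type*} [Field 𝕜]

/-! ### Subalgebras spanned by words -/

/-- The subalgebra of the tensor algebra spanned by the words in a submonoid of words. -/
def wordSpan (𝕜 : Type*) {X : Type*} [Field 𝕜] (P : List X → Prop) (h1 : P [])
    (hm : ∀ u v, P u → P v → P (u ++ v)) : Subalgebra 𝕜 (TensorAlg 𝕜 X) where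
  carrier := Submodule.span 𝕜 {t | ∃ w, P w ∧ t = word 𝕜 w}
  add_mem' ha hb := Submodule.add_mem _ ha hb
  mul_mem' {s t} hs ht := by
    have h : Submodule.span 𝕜 {t | ∃ w, P w ∧ t = word 𝕜 w}
        * Submodule.span 𝕜 {t | ∃ w, P w ∧ t = word 𝕜 w}
        ≤ Submodule.span 𝕜 {t | ∃ w, P w ∧ t = word 𝕜 w} := by
      rw [Submodule.span_mul_span]
      refine Submodule.span_mono ?_
      rintro _ ⟨_, ⟨u, hu, rfl⟩, _, ⟨v, hv, rfl⟩, rfl⟩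
      exact ⟨u ++ v, hm u v hu hv, word_mul u v⟩
    exact h (Submodule.mul_mem_mul hs ht)
  algebraMap_mem' r := by
    rw [Algebra.algebraMap_eq_smul_one, ← word_nil]
    exact Submodule.smul_mem _ _ (Submodule.subset_span ⟨[], h1, rfl⟩)

lemma mem_wordSpan {P : List X → Prop} {h1 : P []} {hm : ∀ u v, P u → P v → P (u ++ v)}
    {t : TensorAlg 𝕜 X} :
    t ∈ wordSpan 𝕜 P h1 hm ↔ t ∈ Submodule.span 𝕜 {t | ∃ w, P w ∧ t = word 𝕜 w} := Iff.rfl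

/-- The span of the words with letters in `S`. -/
def wordsIn (𝕜 : Type*) {X : Type*} [Field 𝕜] (S : Set X) : Subalgebra 𝕜 (TensorAlg 𝕜 X) :=
  wordSpan 𝕜 (fun w => ∀ x ∈ w, x ∈ S) (by simp) (by
    intro u v hu hv x hx
    exact (List.mem_append.1 hx).elim (hu x) (hv x))

/-- The span of the words which have all their letters in `S` or are not shorter than `n`. -/
def wordsInOrLong (𝕜 : Type*) {X : Type*} [Field 𝕜] (S : Set X) (n : ℕ) :
    Subalgebra 𝕜 (TensorAlg 𝕜 X) :=
  wordSpan 𝕜 (fun w => (∀ x ∈ w, x ∈ S) ∨ n ≤ w.length) (by simp) (by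
    rintro u v (hu | hu) (hv | hv)
    · exact Or.inl fun x hx => (List.mem_append.1 hx).elim (hu x) (hv x)
    all_goals exact Or.inr (by rw [List.length_append]; omega))

lemma eq_of_coeffW {s t : TensorAlg 𝕜 X} (h : ∀ u, coeffW u s = coeffW u t) : s = t := by
  apply (MonoidAlgebra.coeffLinearEquiv 𝕜).injective
  ext w
  exact h w.toList

/-! ### Coefficients of the symmetrizer -/

variable [Rack X] (q : TwoCocycle 𝕜 X)

/-- The coefficient of the word `u` in the image of the braided symmetrizer. -/
def symCoeff (u : List X) : TensorAlg 𝕜 X →ₗ[𝕜] 𝕜 := coeffW u ∘ₗ symmetrizer q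

lemma symCoeff_nil (t : TensorAlg 𝕜 X) : symCoeff q [] t = eps t := by
  rw [symCoeff, LinearMap.comp_apply, coeffW_nil, eps_symmetrizer]

/-- Removing the first letter intertwines the symmetrizer with ∂_y, so coefficients can be computed
one letter at a time. -/
lemma symCoeff_cons (y : X) (u : List X) (t : TensorAlg 𝕜 X) :
    symCoeff q (y :: u) t = symCoeff q u (partialD q y t) := by
  rw [symCoeff, symCoeff, LinearMap.comp_apply, LinearMap.comp_apply, coeffW_cons,
    LinearMap.comp_apply, strip_symmetrizer]

/-- The ideal is the kernel of the symmetrizer, so these coefficients are functionals on the Nichols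
algebra. -/
lemma symCoeff_eq_of_toNichols_eq {s t : TensorAlg 𝕜 X} (h : toNichols q s = toNichols q t)
    (u : List X) : symCoeff q u s = symCoeff q u t := by
  have h1 : symmetrizer q (s - t) = 0 := Ideal.Quotient.eq.1 h
  rw [map_sub, sub_eq_zero] at h1
  simp only [symCoeff, LinearMap.comp_apply, h1]

/-- The derivative `∂_y` of a word is a combination of the words that are obtained by deleting a
letter `x` for which the part of the word to the left of it carries `x` to `y`. -/
lemma partialD_word_mem (y : X) (w : List X) : partialD q y (word 𝕜 w) ∈
    Submodule.span 𝕜 {t | ∃ u x v, w = u ++ x :: v ∧ u.foldr (fun z r => z ◃ r) x = y ∧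
      t = word 𝕜 (u ++ v)} := by
  classical
  induction w generalizing y with
  | nil => rw [partialD_nil]; exact Submodule.zero_mem _
  | cons z w ih =>
    rw [← consL_word, partialD_consL]
    refine Submodule.add_mem _ ?_ (Submodule.smul_mem _ _ ?_)
    · by_cases h : z = y
      · rw [if_pos h]
        exact Submodule.subset_span ⟨[], z, w, rfl, h, rfl⟩
      · rw [if_neg h]; exact Submodule.zero_mem _
    · have h1 := Submodule.mem_map_of_mem (f := consL z) (ih (z ◃⁻¹ y))
      rw [Submodule.map_span] at h1
      refine Submodule.span_mono ?_ h1
      rintro _ ⟨_, ⟨u, x, v, rfl, hy, rfl⟩, rfl⟩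
      exact ⟨z :: u, x, v, rfl, by rw [List.foldr_cons, hy, Rack.act_invAct_eq], by simp⟩

/-- The word `u` does not appear in the symmetrizer of a word with letters in `S` that is different
from `u`. -/
def IsRigid (S : Set X) (u : List X) : Prop :=
  ∀ w : List X, (∀ x ∈ w, x ∈ S) → symCoeff q u (word 𝕜 w) ≠ 0 → w = u

lemma isRigid_nil (S : Set X) : IsRigid q S ([] : List X) := by
  intro w _ h
  cases w with
  | nil => rfl
  | cons x w => rw [symCoeff_nil, ← consL_word, eps_consL] at h; exact absurd rfl h

/-- Some term of ∂_y of w must survive, and rigidity forces the word left after the deletion to be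
u. -/
lemma IsRigid.exists_of_ne_zero {S : Set X} {u : List X} (hu : IsRigid q S u) {y : X}
    {w : List X} (hw : ∀ x ∈ w, x ∈ S) (h : symCoeff q (y :: u) (word 𝕜 w) ≠ 0) :
    ∃ u₁ x u₂, w = u₁ ++ x :: u₂ ∧ u₁ ++ u₂ = u ∧ u₁.foldr (fun z r => z ◃ r) x = y := by
  by_contra! hcon
  apply h
  rw [symCoeff_cons]
  have := partialD_word_mem q y w
  refine (Submodule.span_le (p := LinearMap.ker (symCoeff q u))).2 ?_ this
  rintro _ ⟨u₁, x, v, rfl, hy, rfl⟩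
  by_contra h0
  refine hcon u₁ x v rfl (hu _ (fun z hz => hw z ?_) h0) hy
  rcases List.mem_append.1 hz with h1 | h1 <;> simp [h1]

/-- A letter deleted behind a nonempty prefix u₁ of u would be the preimage of y under u₁, which the
hypothesis keeps out of S. Only deletion at the front remains. -/
lemma IsRigid.cons {S : Set X} {u : List X} (hu : IsRigid q S u) {y : X}
    (h : ∀ u₁ u₂ x, u = u₁ ++ u₂ → u₁ ≠ [] → u₁.foldr (fun z r => z ◃ r) x = y → x ∉ S) :
    IsRigid q S (y :: u) := by
  intro w hw h0
  obtain ⟨u₁, x, u₂, rfl, h1, h2⟩ := hu.exists_of_ne_zero q hw h0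
  by_cases h3 : u₁ = []
  · subst h3; simp at h1 h2; simp [h1, h2]
  · exact absurd (hw x (by simp)) (h u₁ u₂ x h1.symm h3 h2)

lemma IsRigid.cons_eq_zero {S : Set X} {u : List X} (hu : IsRigid q S u) {y : X} (hy : y ∉ S)
    (h : ∀ u₁ u₂ x, u = u₁ ++ u₂ → u₁ ≠ [] → u₁.foldr (fun z r => z ◃ r) x = y → x ∉ S)
    {t : TensorAlg 𝕜 X} (ht : t ∈ wordsIn 𝕜 S) : symCoeff q (y :: u) t = 0 := by
  refine (Submodule.span_le (p := LinearMap.ker (symCoeff q (y :: u)))).2 ?_ (mem_wordSpan.1 ht)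
  rintro _ ⟨w, hw, rfl⟩
  by_contra h0
  have := hu.cons q h w hw h0
  exact hy (hw y (by simp [this]))

/-! ### Derivatives of products -/

/-- The element `w⁻¹ ◃ y`. -/
def invWord (w : List X) (y : X) : X := w.foldl (fun r z => z ◃⁻¹ r) y

/-- The scalar by which the degree of `w` carries `v_{w⁻¹ ◃ y}` to `v_y`. -/
def invScalar : List X → X → 𝕜
  | [], _ => 1
  | z :: w, y => q z (z ◃⁻¹ y) * invScalar w (z ◃⁻¹ y)

/-- The skew Leibniz rule: to reach the second factor, ∂_y passes the word w, whose degree acts on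
the index y by its inverse. -/
lemma partialD_word_mul (w : List X) (y : X) (t : TensorAlg 𝕜 X) :
    partialD q y (word 𝕜 w * t) = partialD q y (word 𝕜 w) * t
      + invScalar q w y • (word 𝕜 w * partialD q (invWord w y) t) := by
  classical
  induction w generalizing y with
  | nil => rw [partialD_nil, word_nil, one_mul, zero_mul, zero_add, one_mul, invScalar, one_smul]; rfl
  | cons z w ih =>
    rw [← consL_word, ← consL_mul, partialD_consL, partialD_consL, ih, map_add, map_smul, consL_mul,
      consL_mul, smul_add, smul_smul, add_mul, smul_mul_assoc, ← add_assoc]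
    congr 1
    by_cases h : z = y <;> simp [h]

lemma invWord_cons (z : X) (w : List X) (y : X) :
    invWord (z :: w) y = invWord w (z ◃⁻¹ y) := rfl

/-- The inverse action depends only on the degree in the enveloping group, where g_x g_z = g_{x ▷ z}
g_x. -/
lemma invWord_swap (x z : X) (w : List X) (y : X) :
    invWord ((x ◃ z) :: x :: w) y = invWord (x :: z :: w) y := by
  simp only [invWord_cons]
  congr 1
  rw [← Rack.left_cancel z, ← Rack.left_cancel x, Rack.act_invAct_eq, Rack.act_invAct_eq,
    Shelf.self_distrib, Rack.act_invAct_eq, Rack.act_invAct_eq]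

/-- This is the two-cocycle condition: the scalars also depend only on the degree of the word. -/
lemma invScalar_swap (x z : X) (w : List X) (y : X) :
    invScalar q ((x ◃ z) :: x :: w) y = invScalar q (x :: z :: w) y := by
  have h := invWord_swap x z [] y
  simp only [invWord_cons] at h
  change x ◃⁻¹ (x ◃ z) ◃⁻¹ y = z ◃⁻¹ x ◃⁻¹ y at h
  simp only [invScalar, h]
  obtain ⟨r, rfl⟩ : ∃ r, y = x ◃ z ◃ r := ⟨z ◃⁻¹ x ◃⁻¹ y, by simp⟩
  have h1 : (x ◃ z) ◃⁻¹ (x ◃ z ◃ r) = x ◃ r := by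
    rw [Shelf.self_distrib, Rack.invAct_act_eq]
  rw [h1]
  simp only [Rack.invAct_act_eq]
  have := cocycle_coe q x z r
  linear_combination (invScalar q w r) * this

/-- Three swaps carry the last letter to the front. -/
lemma invWord_rotate (x z s t y : X) :
    invWord [x ◃ z ◃ s ◃ t, x, z, s] y = invWord [x, z, s, t] y := by
  rw [invWord_swap, invWord_cons, invWord_swap, invWord_cons, invWord_swap]; rfl

lemma invScalar_rotate (x z s t y : X) :
    invScalar q [x ◃ z ◃ s ◃ t, x, z, s] y = invScalar q [x, z, s, t] y := by
  rw [invScalar_swap, invScalar, invScalar_swap, invScalar, invScalar_swap]; rfl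

/-! ### Left coideals -/

/-- A subspace of the Nichols algebra which is stable under the skew derivations is a left
coideal. -/
lemma comul_mem_of_partialD (C : Subalgebra 𝕜 (NicholsAlgebra q))
    (hC : ∀ t, toNichols q t ∈ C → ∀ y, toNichols q (partialD q y t) ∈ C)
    {x : NicholsAlgebra q} (hx : x ∈ C) :
    comul q x ∈ LinearMap.range (LinearMap.lTensor (NicholsAlgebra q) C.val.toLinearMap) := by
  obtain ⟨t, rfl⟩ := Ideal.Quotient.mk_surjective x
  change toNichols q t ∈ C at hx
  let C' := Subalgebra.toSubmodule C
  let π : TensorAlg 𝕜 X →ₗ[𝕜] NicholsAlgebra q ⧸ C' := C'.mkQ ∘ₗ (toNichols q).toLinearMap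
  have hπ : ∀ s, toNichols q s ∈ C → π s = 0 := fun s hs =>
    (Submodule.Quotient.mk_eq_zero C').2 hs
  -- Induction on the degree. A tensor vanishes once its part of left degree zero and all its strips
  -- in the left factor vanish. The former is the class of s modulo C, and the strips are the same
  -- expression for ∂_y s, of lower degree.
  have key : ∀ n, ∀ s ∈ wordsLE 𝕜 X n, toNichols q s ∈ C →
      TensorProduct.map (symmetrizer q) π (comulT q s) = 0 := by
    intro n
    have heps : ∀ s, toNichols q s ∈ C → LinearMap.rTensor (NicholsAlgebra q ⧸ C') eps
        (TensorProduct.map (symmetrizer q) π (comulT q s)) = 0 := by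
      intro s hs
      have : LinearMap.rTensor (NicholsAlgebra q ⧸ C') eps
          ∘ₗ TensorProduct.map (symmetrizer q) π
          = LinearMap.lTensor 𝕜 π ∘ₗ LinearMap.rTensor (TensorAlg 𝕜 X) eps := by
        apply TensorProduct.ext'
        intro a b
        simp [eps_symmetrizer]
      have := LinearMap.congr_fun this (comulT q s)
      rw [LinearMap.comp_apply, LinearMap.comp_apply, eps_comulT] at this
      rw [this]; simp [hπ s hs]
    have hstrip : ∀ s y, LinearMap.rTensor (NicholsAlgebra q ⧸ C') (strip y)
        (TensorProduct.map (symmetrizer q) π (comulT q s))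
        = TensorProduct.map (symmetrizer q) π (comulT q (partialD q y s)) := by
      intro s y
      have : LinearMap.rTensor (NicholsAlgebra q ⧸ C') (strip y)
          ∘ₗ TensorProduct.map (symmetrizer q) π
          = TensorProduct.map (symmetrizer q) π
            ∘ₗ LinearMap.rTensor (TensorAlg 𝕜 X) (partialD q y) := by
        apply TensorProduct.ext'
        intro a b
        simp [strip_symmetrizer]
      have := LinearMap.congr_fun this (comulT q s)
      rw [LinearMap.comp_apply, LinearMap.comp_apply, partialD_comulT] at this
      exact this
    induction n with
    | zero =>
      intro s hs h
      refine tensor_eq_zero _ (heps s h) fun y => ?_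
      have : partialD q y s = 0 := by
        clear h
        induction hs using Submodule.span_induction with
        | mem t ht =>
          obtain ⟨w, hw, rfl⟩ := ht
          have : w = [] := by simpa using hw
          rw [this, partialD_nil]
        | zero => simp
        | add a b _ _ ha hb => rw [map_add, ha, hb, add_zero]
        | smul c a _ ha => rw [map_smul, ha, smul_zero]
      rw [hstrip, this, map_zero, map_zero]
    | succ n ih =>
      intro s hs h
      refine tensor_eq_zero _ (heps s h) fun y => ?_
      rw [hstrip]
      exact ih _ (partialD_mem_LE q _ _ _ hs) (hC s h y)
  obtain ⟨n, hn⟩ := exists_mem_wordsLE t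
  have h1 := key n t hn hx
  -- The symmetrizer embeds the Nichols algebra into the tensor algebra. By flatness the vanishing
  -- descends to B ⊗ B/C, and exactness places the coproduct in B ⊗ C.
  let i : NicholsAlgebra q →ₗ[𝕜] TensorAlg 𝕜 X :=
    ((nicholsIdeal q).restrictScalars 𝕜).liftQ (symmetrizer q) (fun _ ht => ht) ∘ₗ
      (Submodule.Quotient.restrictScalarsEquiv 𝕜 (nicholsIdeal q)).symm.toLinearMap
  have hi : ∀ t, i (toNichols q t) = symmetrizer q t := fun t => rfl
  have hinj : Function.Injective i := by
    rw [injective_iff_map_eq_zero]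
    intro b hb
    obtain ⟨t, rfl⟩ := Ideal.Quotient.mk_surjective b
    exact Ideal.Quotient.eq_zero_iff_mem.2 ((hi t).symm.trans hb)
  have h2 : LinearMap.rTensor (NicholsAlgebra q ⧸ C') i
      (LinearMap.lTensor (NicholsAlgebra q) C'.mkQ (comul q (toNichols q t))) = 0 := by
    rw [comul_toNichols]
    have : (LinearMap.rTensor (NicholsAlgebra q ⧸ C') i ∘ₗ
        LinearMap.lTensor (NicholsAlgebra q) C'.mkQ) ∘ₗ
        TensorProduct.map (toNichols q).toLinearMap (toNichols q).toLinearMap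
        = TensorProduct.map (symmetrizer q) π := by
      apply TensorProduct.ext'
      intro a b
      simp [hi, π]
    exact (LinearMap.congr_fun this (comulT q t)).trans h1
  have h3 := Module.Flat.rTensor_preserves_injective_linearMap (M := NicholsAlgebra q ⧸ C') i hinj
  have h4 : LinearMap.lTensor (NicholsAlgebra q) C'.mkQ (comul q (toNichols q t)) = 0 :=
    h3 (by rw [h2, map_zero])
  have hex : Function.Exact C'.subtype C'.mkQ := by
    rw [LinearMap.exact_iff]; simp
  exact (lTensor_exact (NicholsAlgebra q) hex (Submodule.mkQ_surjective C') _).1 h4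

/-- The subalgebra generated by a set `S` of letters and a tensor `z` is carried to a subalgebra of
the Nichols algebra stable under the skew derivations, if the derivatives of `z` are in it and `z`
satisfies a Leibniz rule. -/
lemma partialD_mem_adjoin (A : Subalgebra 𝕜 (TensorAlg 𝕜 X)) (S : Set (TensorAlg 𝕜 X))
    (hA : A = Algebra.adjoin 𝕜 S)
    (hS : ∀ s ∈ S, ∀ y, toNichols q (partialD q y s) ∈ A.map (toNichols q) ∧
      ∃ (r : 𝕜) (x : X), ∀ t, partialD q y (s * t) = partialD q y s * t + r • (s * partialD q x t))
    (t : TensorAlg 𝕜 X) (ht : toNichols q t ∈ A.map (toNichols q)) (y : X) :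
    toNichols q (partialD q y t) ∈ A.map (toNichols q) := by
  have key : ∀ t ∈ A, ∀ y, toNichols q (partialD q y t) ∈ A.map (toNichols q) := by
    intro t ht
    rw [hA, ← Subalgebra.mem_toSubmodule, Algebra.adjoin_eq_span] at ht
    induction ht using Submodule.span_induction with
    | mem t ht =>
      induction ht using Submonoid.closure_induction_left with
      | one => intro y; rw [← word_nil, partialD_nil, map_zero]; exact zero_mem _
      | mul_left s hs t ht ih =>
        intro y
        obtain ⟨h1, r, x, h2⟩ := hS s hs y
        have hsA : s ∈ A := hA ▸ Algebra.subset_adjoin hs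
        have htA : t ∈ A := by
          rw [hA, ← Subalgebra.mem_toSubmodule, Algebra.adjoin_eq_span]
          exact Submodule.subset_span ht
        rw [h2, map_add, map_mul, map_smul, map_mul]
        exact add_mem (mul_mem h1 (Subalgebra.mem_map.2 ⟨t, htA, rfl⟩))
          (Subalgebra.smul_mem _ (mul_mem (Subalgebra.mem_map.2 ⟨s, hsA, rfl⟩) (ih x)) r)
    | zero => intro y; simp
    | add a b _ _ ha hb => intro y; rw [map_add, map_add]; exact add_mem (ha y) (hb y)
    | smul c a _ ha => intro y; rw [map_smul, map_smul]; exact Subalgebra.smul_mem _ (ha y) c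
  -- A representative t need not lie in A, but it differs from some s in A by an element of the
  -- ideal, which is stable under ∂_y.
  obtain ⟨s, hs, hst⟩ := ht
  have h0 : symmetrizer q (t - s) = 0 := Ideal.Quotient.eq.1 hst.symm
  have h1 : toNichols q (partialD q y (t - s)) = 0 :=
    Ideal.Quotient.eq_zero_iff_mem.2 (partialD_mem q h0 y)
  rw [map_sub, map_sub, sub_eq_zero] at h1
  rw [h1]
  exact key s hs y

/-! ### Homogeneous generators -/

/-- The generated algebra is spanned by products of homogeneous generators, which are homogeneous. A
general monoid of degrees covers both gradings. -/
lemma toSubmodule_adjoin_eq_iSup {A ι : Type*} [Ring A] [Algebra 𝕜 A] [Monoid ι]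
    (P : ι → Submodule 𝕜 A) (h1 : 1 ∈ P 1) (hm : ∀ i j, ∀ x ∈ P i, ∀ y ∈ P j, x * y ∈ P (i * j))
    (S : Set A) (hS : ∀ s ∈ S, ∃ i, s ∈ P i) :
    Subalgebra.toSubmodule (Algebra.adjoin 𝕜 S)
      = ⨆ i, Subalgebra.toSubmodule (Algebra.adjoin 𝕜 S) ⊓ P i := by
  refine le_antisymm ?_ (iSup_le fun i => inf_le_left)
  rw [Algebra.adjoin_eq_span]
  refine Submodule.span_le.2 fun x hx => ?_
  have : ∃ i, x ∈ P i := by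
    induction hx using Submonoid.closure_induction with
    | mem x hx => exact hS x hx
    | one => exact ⟨1, h1⟩
    | mul x y _ _ hx hy =>
      obtain ⟨i, hi⟩ := hx
      obtain ⟨j, hj⟩ := hy
      exact ⟨i * j, hm i j x hi y hj⟩
  obtain ⟨i, hi⟩ := this
  exact Submodule.mem_iSup_of_mem i ⟨Submodule.subset_span hx, hi⟩

/-- The product of the images of two spans of words. -/
lemma mul_mem_map_span {P Q R : List X → Prop} (h : ∀ u v, P u → Q v → R (u ++ v))
    {x y : NicholsAlgebra q}
    (hx : x ∈ (Submodule.span 𝕜 {t | ∃ w, P w ∧ t = word 𝕜 w}).map (toNichols q).toLinearMap)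
    (hy : y ∈ (Submodule.span 𝕜 {t | ∃ w, Q w ∧ t = word 𝕜 w}).map (toNichols q).toLinearMap) :
    x * y ∈ (Submodule.span 𝕜 {t | ∃ w, R w ∧ t = word 𝕜 w}).map (toNichols q).toLinearMap := by
  obtain ⟨s, hs, rfl⟩ := hx
  obtain ⟨t, ht, rfl⟩ := hy
  refine ⟨s * t, ?_, map_mul (toNichols q) s t⟩
  have h0 : Submodule.span 𝕜 {t | ∃ w, P w ∧ t = word 𝕜 w}
      * Submodule.span 𝕜 {t | ∃ w, Q w ∧ t = word 𝕜 w}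
      ≤ Submodule.span 𝕜 {t | ∃ w, R w ∧ t = word 𝕜 w} := by
    rw [Submodule.span_mul_span]
    refine Submodule.span_mono ?_
    rintro _ ⟨_, ⟨u, hu, rfl⟩, _, ⟨v, hv, rfl⟩, rfl⟩
    exact ⟨u ++ v, h u v hu hv, word_mul u v⟩
  exact h0 (Submodule.mul_mem_mul hs ht)

lemma toSubmodule_adjoin_graded (S : Set (NicholsAlgebra q)) (hS : ∀ s ∈ S, ∃ n, s ∈ degreePart q n) :
    Subalgebra.toSubmodule (Algebra.adjoin 𝕜 S)
      = ⨆ n, Subalgebra.toSubmodule (Algebra.adjoin 𝕜 S) ⊓ degreePart q n :=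
  toSubmodule_adjoin_eq_iSup (ι := Multiplicative ℕ) (fun n => degreePart q n.toAdd)
    ⟨word 𝕜 [], Submodule.subset_span ⟨[], rfl, rfl⟩, map_one (toNichols q)⟩
    (fun i j x hx y hy => mul_mem_map_span q (fun u v hu hv => by
      rw [List.length_append, hu, hv]; rfl) hx hy) S hS

lemma toSubmodule_adjoin_subcomodule (S : Set (NicholsAlgebra q))
    (hS : ∀ s ∈ S, ∃ g, s ∈ groupPart q g) :
    Subalgebra.toSubmodule (Algebra.adjoin 𝕜 S)
      = ⨆ g, Subalgebra.toSubmodule (Algebra.adjoin 𝕜 S) ⊓ groupPart q g :=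
  toSubmodule_adjoin_eq_iSup (fun g => groupPart q g)
    ⟨word 𝕜 [], Submodule.subset_span ⟨[], by simp [envelDegree], rfl⟩, map_one (toNichols q)⟩
    (fun i j x hx y hy => mul_mem_map_span q (fun u v hu hv => by
      rw [envelDegree, List.map_append, List.prod_append, ← hu, ← hv]; rfl) hx hy) S hS

lemma envelDegree_swap (x y : X) (w : List X) :
    envelDegree ((x ◃ y) :: x :: w) = envelDegree (x :: y :: w) := by
  simp only [envelDegree, List.map_cons, List.prod_cons]
  have h : (Rack.toEnvelGroup X (x ◃ y) : Rack.EnvelGroup X)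
      = (Rack.toEnvelGroup X x : Rack.EnvelGroup X) * (Rack.toEnvelGroup X y : Rack.EnvelGroup X)
        * (Rack.toEnvelGroup X x : Rack.EnvelGroup X)⁻¹ :=
    (Rack.toEnvelGroup X).map_act
  rw [h]; group

lemma envelDegree_cons (x : X) (w : List X) :
    envelDegree (x :: w) = (Rack.toEnvelGroup X x : Rack.EnvelGroup X) * envelDegree w := rfl

/-- Hence the four words in Z have one common group degree. -/
lemma envelDegree_rotate (x y z t : X) :
    envelDegree [x ◃ y ◃ z ◃ t, x, y, z] = envelDegree [x, y, z, t] := by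
  rw [envelDegree_swap, envelDegree_cons, envelDegree_swap, envelDegree_cons, envelDegree_swap]; rfl

/-! ### The component of degree one -/

lemma symCoeff_singleton (y : X) (t : TensorAlg 𝕜 X) : symCoeff q [y] t = coeffW [y] t := by
  classical
  have : symCoeff q [y] = coeffW [y] := by
    refine ext_words fun w => ?_
    rw [symCoeff_cons, symCoeff_nil]
    rcases w with _ | ⟨x, _ | ⟨z, w⟩⟩
    · rw [partialD_nil, map_zero, coeffW_word]; simp
    · rw [← consL_word, partialD_consL, partialD_nil, consL_word, coeffW_word]
      by_cases h : x = y <;> simp [h]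
    · rw [eps_of_len w.length, coeffW_word]
      · simp
      · have h1 := partialD_word_mem q y (x :: z :: w)
        refine Submodule.span_mono ?_ h1
        rintro _ ⟨u, s, v, h, -, rfl⟩
        refine ⟨u ++ v, ?_, rfl⟩
        have := congrArg List.length h
        simp only [List.length_cons, List.length_append] at this ⊢
        omega
  rw [this]

/-- The elements of degree one of a subalgebra which is generated by letters in `S` and by elements
of degree at least two. -/
lemma mem_map_wordsIn_of_degree_one {S : Set X} {t : TensorAlg 𝕜 X}
    (ht : t ∈ wordsInOrLong 𝕜 S 2) (h : toNichols q t ∈ degreePart q 1) :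
    toNichols q t ∈ (wordsIn 𝕜 S).map (toNichols q) := by
  classical
  obtain ⟨s, hs, hst⟩ := h
  -- The coefficient of a one-letter word depends only on the class in the Nichols algebra, so it
  -- can be read off from t, whose one-letter words lie in S.
  have h1 : ∀ y ∉ S, coeffW [y] s = 0 := by
    intro y hy
    rw [← symCoeff_singleton q, symCoeff_eq_of_toNichols_eq q hst, symCoeff_singleton]
    refine (Submodule.span_le (p := LinearMap.ker (coeffW [y]))).2 ?_ (mem_wordSpan.1 ht)
    rintro _ ⟨w, hw, rfl⟩
    change coeffW [y] (word 𝕜 w) = 0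
    rw [coeffW_word, if_neg]
    rintro rfl
    rcases hw with hw | hw
    · exact hy (hw y (by simp))
    · simp at hw
  refine ⟨s, ?_, hst⟩
  -- The projection onto the words with letters in S. It fixes s, since s has degree one and no
  -- coefficient outside S.
  let p : Module.End 𝕜 (TensorAlg 𝕜 X) := onWords fun w => if ∀ x ∈ w, x ∈ S then word 𝕜 w else 0
  have hp : ∀ w, p (word 𝕜 w) = if ∀ x ∈ w, x ∈ S then word 𝕜 w else 0 := fun w => by simp [p]
  have h2 : ∀ s, p s ∈ wordsIn 𝕜 S := by
    intro s
    obtain ⟨n, hn⟩ := exists_mem_wordsLE s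
    refine (Submodule.span_le (p := (Subalgebra.toSubmodule (wordsIn 𝕜 S)).comap p)).2 ?_ hn
    rintro _ ⟨w, -, rfl⟩
    change p (word 𝕜 w) ∈ wordsIn 𝕜 S
    rw [hp]
    by_cases h : ∀ x ∈ w, x ∈ S
    · rw [if_pos h]; exact Submodule.subset_span ⟨w, h, rfl⟩
    · rw [if_neg h]; exact zero_mem _
  have h3 : ∀ s ∈ wordsLen 𝕜 X 1, (∀ y ∉ S, coeffW [y] s = 0) → p s = s := by
    intro s hs h
    refine eq_of_coeffW fun u => ?_
    have : coeffW u (p s) = if (∃ y ∉ S, u = [y]) then 0 else coeffW u s := by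
      clear h
      induction hs using Submodule.span_induction with
      | mem t ht =>
        obtain ⟨w, hw, rfl⟩ := ht
        obtain ⟨x, rfl⟩ := List.length_eq_one_iff.1 hw
        rw [hp]
        by_cases hx : x ∈ S
        · rw [if_pos (by simpa using hx), coeffW_word]
          by_cases hu : [x] = u
          · subst hu; simp [hx]
          · simp [hu]
        · rw [if_neg (by simpa using hx), map_zero, coeffW_word]
          by_cases hu : [x] = u
          · subst hu; simp [hx]
          · simp [hu]
      | zero => simp
      | add a b _ _ ha hb => rw [map_add, map_add, map_add, ha, hb]; split_ifs <;> simp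
      | smul c a _ ha => rw [map_smul, map_smul, map_smul, ha]; split_ifs <;> simp
    rw [this]
    split_ifs with hu
    · obtain ⟨y, hy, rfl⟩ := hu; rw [h y hy]
    · rfl
  exact h3 s hs h1 ▸ h2 s

end RackNichols
end

noncomputable section

namespace RackNichols

variable {𝕜 : Type*} {X : Type*} [Field 𝕜]

open Classical in
/-- The coefficient of `v_y` in `v_x`. -/
def delta (𝕜 : Type*) {X : Type*} [Field 𝕜] (y x : X) : 𝕜 := if x = y then 1 else 0

lemma delta_self (y : X) : delta 𝕜 y y = 1 := if_pos rfl

lemma delta_of_ne {x y : X} (h : x ≠ y) : delta 𝕜 y x = 0 := if_neg h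

variable [Rack X] (q : TwoCocycle 𝕜 X)

/-! ### Relations in degree two -/

lemma toNichols_word_cons (x : X) (w : List X) :
    toNichols q (word 𝕜 (x :: w)) = gen q x * toNichols q (word 𝕜 w) := by
  rw [word_cons, map_mul]; rfl

lemma toNichols_word_nil : toNichols q (word 𝕜 ([] : List X)) = 1 := map_one _

lemma symCoeff_pair (x y z t : X) : symCoeff q [z, t] (word 𝕜 [x, y])
    = open Classical in (if x = z ∧ y = t then 1 else 0)
      + if x ◃ y = z ∧ x = t then (q x y : 𝕜) else 0 := by
  classical
  rw [symCoeff_cons, symCoeff_singleton, ← consL_word, partialD_consL, ← consL_word, partialD_consL,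
    partialD_nil, map_zero, smul_zero, add_zero, map_add, map_smul]
  congr 1
  · by_cases h : x = z <;> simp [h, coeffW_word]
  · by_cases h : x ◃ y = z
    · subst h; simp [coeffW_word]
    · have : y ≠ x ◃⁻¹ z := by rintro rfl; exact h (Rack.act_invAct_eq _ _)
      simp [h, this]

section Slim

variable {q}

lemma SlimInDegreeTwo.tensor_comm (hslim : SlimInDegreeTwo q) {x y : X} (h : x ◃ y = y)
    (hne : x ≠ y) :
    toNichols q (word 𝕜 [x, y] - (q x y : 𝕜) • word 𝕜 [y, x]) = 0 := by
  have := hslim.1 x y h hne.symm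
  simpa [braid, braidWord, h] using this

lemma SlimInDegreeTwo.tensor_triangle (hslim : SlimInDegreeTwo q) {x y z : X}
    (h : IsTriangle x y z) :
    toNichols q (word 𝕜 [x, y] - (q x y : 𝕜) • word 𝕜 [z, x]
      + ((q x y : 𝕜) * q z x) • word 𝕜 [y, z]) = 0 := by
  have := hslim.2 x y h.noncomm
  simpa [braid, braidWord, h.xy, h.zx, pow_two, smul_smul] using this

lemma SlimInDegreeTwo.gen_mul_gen_comm (hslim : SlimInDegreeTwo q) {x y : X} (h : x ◃ y = y)
    (hne : x ≠ y) : gen q x * gen q y = (q x y : 𝕜) • (gen q y * gen q x) := by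
  have := hslim.tensor_comm h hne
  rw [map_sub, map_smul, sub_eq_zero] at this
  simpa [toNichols_word_cons, toNichols_word_nil] using this

lemma SlimInDegreeTwo.gen_mul_gen (hslim : SlimInDegreeTwo q) {x y z : X}
    (h : IsTriangle x y z) : gen q x * gen q y
      = (q x y : 𝕜) • (gen q z * gen q x) - ((q x y : 𝕜) * q z x) • (gen q y * gen q z) := by
  have := hslim.tensor_triangle h
  rw [map_add, map_sub, map_smul, map_smul] at this
  simp only [toNichols_word_cons, toNichols_word_nil, mul_one] at this
  rw [← sub_eq_zero, ← this]; abel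

/-- The relation lies in the kernel of 1 + c, and its coefficient at xy there is 1 - q_{x,y}
q_{y,x}. The triangle identity below arises in the same way and is the source of the signs. -/
lemma SlimInDegreeTwo.cocycle_comm (hslim : SlimInDegreeTwo q) {x y : X} (h : x ◃ y = y)
    (h' : y ◃ x = x) (hne : x ≠ y) : (q x y : 𝕜) * q y x = 1 := by
  have := symCoeff_eq_of_toNichols_eq q ((hslim.tensor_comm h hne).trans (map_zero _).symm) [x, y]
  rw [map_zero, map_sub, map_smul, symCoeff_pair, symCoeff_pair] at this
  simp only [h, h', hne, hne.symm, and_self, if_true, if_false, smul_eq_mul,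
    zero_add, add_zero] at this
  linear_combination -this

lemma SlimInDegreeTwo.cocycle_triangle (hslim : SlimInDegreeTwo q) {x y z : X}
    (h : IsTriangle x y z) : (q x y : 𝕜) * q z x * q y z = -1 := by
  have := symCoeff_eq_of_toNichols_eq q ((hslim.tensor_triangle h).trans (map_zero _).symm) [x, y]
  rw [map_zero, map_add, map_sub, map_smul, map_smul, symCoeff_pair, symCoeff_pair,
    symCoeff_pair] at this
  simp only [h.xy, h.yz, h.zx, h.ne, h.ne.symm, h.ne''.symm, h.ne'.symm, and_self, if_true,
    if_false, smul_eq_mul, zero_add, add_zero, mul_zero, sub_zero] at this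
  linear_combination this

end Slim

/-- Rewrites acd through eac, gea and cdg. In ∂_{b'} Z the first two cancel against derivatives of
eabc and gfea, leaving cdg. The next lemma does the same for abd in ∂_h Z. -/
lemma mul_mul_of_relations {R : Type*} [Ring R] [Algebra 𝕜 R] {A C D E G : R} {s t u v w : 𝕜}
    (h1 : A * C = s • (C * A)) (h2 : A * D = t • (G * A) - (t * u) • (D * G))
    (h3 : C * G = v • (E * C) - (v * w) • (G * E)) :
    A * C * D = (t * v) • (E * A * C) - (s * t * v * w) • (G * E * A)
      - (s * t * u) • (C * D * G) := by
  have h4 : E * A * C = s • (E * C * A) := by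
    rw [mul_assoc, h1, mul_smul_comm, ← mul_assoc]
  have h5 : C * G * A = v • (E * C * A) - (v * w) • (G * E * A) := by
    rw [h3, sub_mul, smul_mul_assoc, smul_mul_assoc]
  rw [h1, smul_mul_assoc, mul_assoc, h2, mul_sub, mul_smul_comm, mul_smul_comm, ← mul_assoc, h5, h4,
    ← mul_assoc]
  module

lemma mul_mul_of_relations' {R : Type*} [Ring R] [Algebra 𝕜 R] {A B D F G : R} {r s t u v : 𝕜}
    (h1 : B * D = r • (F * B) - (r * v) • (D * F)) (h2 : A * F = s • (F * A))
    (h3 : A * D = t • (G * A) - (t * u) • (D * G)) :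
    A * B * D = (r * s) • (F * A * B) - (r * v * t * s) • (G * F * A)
      + (r * v * t * u) • (D * G * F) := by
  have h4 : A * F * B = s • (F * A * B) := by rw [h2, smul_mul_assoc]
  have h5 : A * D * F = (t * s) • (G * F * A) - (t * u) • (D * G * F) := by
    rw [h3, sub_mul, smul_mul_assoc, smul_mul_assoc, mul_assoc, h2, mul_smul_comm, ← mul_assoc,
      smul_smul]
  rw [mul_assoc, h1, mul_sub, mul_smul_comm, mul_smul_comm, ← mul_assoc, ← mul_assoc, h4, h5]
  module

/-! ### Derivatives of words of length four -/

section Derivative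

/-- Removes inverse actions from the indices, so that the derivatives of words involve only products
in the rack. -/
lemma delta_invAct (x y z : X) :
    (q x (x ◃⁻¹ y) : 𝕜) * delta 𝕜 (x ◃⁻¹ y) z = q x z * delta 𝕜 y (x ◃ z) := by
  unfold delta
  by_cases h : x ◃ z = y
  · subst h; simp
  · have : z ≠ x ◃⁻¹ y := by rintro rfl; exact h (Rack.act_invAct_eq _ _)
    simp [h, this]

lemma delta_invAct_mul (x y z : X) (r : 𝕜) :
    (q x (x ◃⁻¹ y) : 𝕜) * (r * delta 𝕜 (x ◃⁻¹ y) z) = r * (q x z * delta 𝕜 y (x ◃ z)) := by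
  rw [mul_left_comm, delta_invAct]

lemma delta_invAct_mul_mul (x y z : X) (r s : 𝕜) :
    (q x (x ◃⁻¹ y) : 𝕜) * (r * (s * delta 𝕜 (x ◃⁻¹ y) z))
      = r * (s * (q x z * delta 𝕜 y (x ◃ z))) := by
  rw [mul_left_comm, delta_invAct_mul]

lemma partialD_word_cons (x y : X) (w : List X) :
    partialD q y (word 𝕜 (x :: w)) = delta 𝕜 y x • word 𝕜 w
      + (q x (x ◃⁻¹ y) : 𝕜) • consL x (partialD q (x ◃⁻¹ y) (word 𝕜 w)) := by
  rw [← consL_word, partialD_consL, delta]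
  by_cases h : x = y <;> simp [h]

lemma partialD_word_two (y x z : X) : partialD q y (word 𝕜 [x, z]) =
    delta 𝕜 y x • word 𝕜 [z] + (q x z * delta 𝕜 y (x ◃ z)) • word 𝕜 [x] := by
  rw [partialD_word_cons, partialD_word_cons, partialD_nil]
  simp only [map_zero, smul_zero, add_zero, map_smul, consL_word, smul_smul, delta_invAct]

lemma partialD_word_three (y x z s : X) : partialD q y (word 𝕜 [x, z, s]) =
    delta 𝕜 y x • word 𝕜 [z, s] + (q x z * delta 𝕜 y (x ◃ z)) • word 𝕜 [x, s]
      + (q z s * (q x (z ◃ s) * delta 𝕜 y (x ◃ z ◃ s))) • word 𝕜 [x, z] := by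
  rw [partialD_word_cons, partialD_word_two]
  simp only [map_add, map_smul, consL_word, smul_add, add_assoc, smul_smul, delta_invAct,
    delta_invAct_mul]

lemma partialD_word_four (y x z s t : X) : partialD q y (word 𝕜 [x, z, s, t]) =
    delta 𝕜 y x • word 𝕜 [z, s, t] + (q x z * delta 𝕜 y (x ◃ z)) • word 𝕜 [x, s, t]
      + (q z s * (q x (z ◃ s) * delta 𝕜 y (x ◃ z ◃ s))) • word 𝕜 [x, z, t]
      + (q s t * (q z (s ◃ t) * (q x (z ◃ s ◃ t) * delta 𝕜 y (x ◃ z ◃ s ◃ t)))) •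
        word 𝕜 [x, z, s] := by
  rw [partialD_word_cons, partialD_word_three]
  simp only [map_add, map_smul, consL_word, smul_add, add_assoc, smul_smul, delta_invAct,
    delta_invAct_mul, delta_invAct_mul_mul]

end Derivative

/-! ### The element `Z` -/

lemma braid_rotate {x y z t u v w : X} (hu : z ◃ t = u) (hv : y ◃ u = v) (hw : x ◃ v = w) :
    (braid q 0 * braid q 1 * braid q 2 : Module.End 𝕜 (TensorAlg 𝕜 X)) (word 𝕜 [x, y, z, t])
      = ((q z t : 𝕜) * q y u * q x v) • word 𝕜 [w, x, y, z] := by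
  subst hu hv hw
  simp [braid, braidWord, smul_smul, Module.End.mul_apply, mul_assoc]

/-- The tensor that represents `Z(a,b,c,d)`. -/
def tensorZ (a b c d : X) : TensorAlg 𝕜 X :=
  (1 - braid q 0 * braid q 1 * braid q 2
    + (braid q 0 * braid q 1 * braid q 2) ^ 2
    - (braid q 0 * braid q 1 * braid q 2) ^ 3 : Module.End 𝕜 (TensorAlg 𝕜 X)) (word 𝕜 [a, b, c, d])

namespace Config

variable {q} {a b c d e f g m p b' h k : X}

lemma tensorZ_eq (H : Config a b c d e f g m p b' h k) (hX : IsBraidedRack X) {r s t : 𝕜}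
    (hr : r = q c d * q b m * q a m) (hs : s = q b c * q a p * q e h)
    (ht : t = q a b * q e b' * q f b') : tensorZ q a b c d = word 𝕜 [a, b, c, d]
      - r • word 𝕜 [e, a, b, c] + (r * s) • word 𝕜 [f, e, a, b]
      - (r * s * t) • word 𝕜 [g, f, e, a] := by
  have h1 := braid_rotate q H.cdm.xy H.bm H.ame.xy
  have h2 := braid_rotate q H.bcp.xy H.aph.xy (H.e_act_h hX)
  have h3 := braid_rotate q H.abb'.xy H.eb' H.f_act_b'
  rw [← hr] at h1
  rw [← hs] at h2
  rw [← ht] at h3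
  rw [tensorZ]
  -- The rotation is made opaque so that unfolding products of endomorphisms does not split it into
  -- single braidings.
  generalize braid q 0 * braid q 1 * braid q 2 = T at h1 h2 h3
  have h4 : T ^ 3 = T * (T * T) := by rw [pow_succ', pow_two]
  rw [h4, pow_two]
  simp only [LinearMap.sub_apply, LinearMap.add_apply, Module.End.one_apply, Module.End.mul_apply,
    h1, h2, h3, map_smul, smul_smul]

variable (q) in
/-- The derivatives of `Z`. -/
lemma partialD_tensorZ (H : Config a b c d e f g m p b' h k) (hX : IsBraidedRack X)
    (hslim : SlimInDegreeTwo q) : ∃ r₁ r₂ r₃ r₄ r₅ : 𝕜, ∀ y,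
    toNichols q (partialD q y (tensorZ q a b c d)) = delta 𝕜 y a • (gen q b * gen q c * gen q d)
      + (r₁ * delta 𝕜 y m) • (gen q e * gen q b * gen q c)
      + (r₂ * delta 𝕜 y p) • (gen q f * gen q e * gen q b)
      + (r₃ * delta 𝕜 y k) • (gen q g * gen q f * gen q e)
      + (r₄ * delta 𝕜 y b') • (gen q c * gen q d * gen q g)
      + (r₅ * delta 𝕜 y h) • (gen q d * gen q g * gen q f) := by
  obtain ⟨r, hr⟩ : ∃ r : 𝕜, r = q c d * q b m * q a m := ⟨_, rfl⟩
  obtain ⟨s, hs⟩ : ∃ s : 𝕜, s = q b c * q a p * q e h := ⟨_, rfl⟩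
  obtain ⟨t, ht⟩ : ∃ t : 𝕜, t = q a b * q e b' * q f b' := ⟨_, rfl⟩
  have n0 : ∀ x y : X, (q x y : 𝕜) ≠ 0 := fun x y => (q x y).ne_zero
  have hmb : (q b m : 𝕜) * q m b = 1 := hslim.cocycle_comm H.bm (hX.comm_symm H.bm) H.bm_ne
  have heb' : (q e b' : 𝕜) = q m b := by
    have := cocycle_coe q a m b
    rw [H.ame.xy, H.abb'.xy, hX.comm_symm H.bm] at this
    exact mul_right_cancel₀ (n0 a b) (by linear_combination this)
  have hgh : (q g h : 𝕜) = q b m := by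
    have h1 := cocycle_coe q a d p
    have h2 := cocycle_coe q f b m
    rw [H.adg.xy, H.aph.xy, H.dp] at h1
    rw [H.bdf.zx, H.fmp.xy, H.bm] at h2
    have h3 := mul_right_cancel₀ (n0 a p) (h1.trans (mul_comm _ _))
    exact h3.trans (mul_right_cancel₀ (n0 f m) (h2.trans (mul_comm _ _)))
  -- The identities `i1` and `i2` cancel eac and gea at y = b'. The identities `i3` and `i4` cancel
  -- fab and gfa at y = h.
  have i1 : (q a d : 𝕜) * q c g = r * q e b' := by
    have := cocycle_coe q a c d
    rw [H.ac, H.adg.xy, H.cdm.xy] at this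
    rw [hr, heb']
    linear_combination this - (q c d * q a m : 𝕜) * hmb
  have i2 : (q a b * q a c * q a d * q c g * q e c : 𝕜) = - (r * s * t * q g f) := by
    have h1 := hslim.cocycle_triangle H.gfb'
    have h2 := cocycle_coe q a m c
    have h3 := cocycle_coe q a b d
    have h4 := cocycle_coe q a m p
    have h5 := cocycle_coe q m b c
    rw [H.ame.xy, H.ac, H.cdm.zx] at h2
    rw [H.abb'.xy, H.adg.xy, H.bdf.xy] at h3
    rw [H.ame.xy, H.aph.xy, H.fmp.yz] at h4
    rw [hX.comm_symm H.bm, H.cdm.zx, H.bcp.xy] at h5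
    have h6 : (q a c * q e c * q b' g : 𝕜) = s := by
      rw [hs]
      refine mul_right_cancel₀ (n0 a d) ?_
      linear_combination (q b' g * q a d : 𝕜) * h2 + (q a d * q m c : 𝕜) * h3
        + (q a d * q a f : 𝕜) * h5 - (q a d * q b c : 𝕜) * h4
    refine mul_right_cancel₀ (n0 b' g) ?_
    rw [ht]
    linear_combination (q a b * q a d * q c g : 𝕜) * h6 + (q a b * s : 𝕜) * i1
      + (q a b * s * r * q e b' : 𝕜) * h1
  have i4 : (q f b * q a d : 𝕜) = t * q g h := by
    have h1 := cocycle_coe q a f b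
    rw [H.af, H.abb'.xy, H.bdf.zx] at h1
    rw [ht, hgh, heb']
    linear_combination -(q m b * q b m : 𝕜) * h1 - (q a d * q f b : 𝕜) * hmb
  have i3 : (q b c * q a p * q b d * q a f : 𝕜) = - (r * s * q f e) := by
    have h1 := hslim.cocycle_triangle H.feh
    have h2 := cocycle_coe q b c d
    have h3 := cocycle_coe q a p f
    rw [H.bcp.xy, H.bdf.xy, H.cdm.xy] at h2
    rw [H.aph.xy, H.af, H.fmp.zx] at h3
    refine mul_right_cancel₀ (n0 h f) ?_
    rw [hs]
    rw [hr] at *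
    linear_combination (q b c * q a p * q b d : 𝕜) * h3 + (q b c * q a p * q a m : 𝕜) * h2
      + (q b c * q a p * (q c d * q b m * q a m) : 𝕜) * h1
  have x1 := mul_mul_of_relations (hslim.gen_mul_gen_comm H.ac H.ac_ne) (hslim.gen_mul_gen H.adg)
    (hslim.gen_mul_gen H.cge)
  have x2 := mul_mul_of_relations' (hslim.gen_mul_gen H.bdf) (hslim.gen_mul_gen_comm H.af H.af_ne)
    (hslim.gen_mul_gen H.adg)
  refine ⟨-(r * q e a), r * s * q e a * q f m, -(r * s * t * q e a * q f m * q g p),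
    -(q a b * q a c * q a d * q g a), q b c * q a p * q b d * q f b * q a d * q g a, fun y => ?_⟩
  rw [H.tensorZ_eq hX hr hs ht]
  simp only [map_add, map_sub, map_smul, partialD_word_four]
  simp only [H.cdm.xy, H.bm, H.ame.xy, H.bcp.xy, H.aph.xy, H.e_act_h hX, H.abb'.xy, H.eb',
    H.f_act_b', H.ame.zx, H.fmp.xy, H.gpk.xy, H.feh.xy, H.gh, H.gfb'.xy]
  simp only [toNichols_word_cons, toNichols_word_nil, mul_one, ← mul_assoc, x1, x2]
  -- Compares the coefficients of the cubic monomials. The remaining goals are the four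
  -- cancellations at b' and h, then those of abc, eab, fea at y = e, f, g, which are the
  -- definitions of r, s, t.
  match_scalars
  all_goals try ring1
  · linear_combination (q a b * delta 𝕜 y b' : 𝕜) * i1
  · linear_combination -(delta 𝕜 y b' : 𝕜) * i2
  · linear_combination (delta 𝕜 y h : 𝕜) * i3
  · linear_combination -(delta 𝕜 y h * q f b * q a d : 𝕜) * i3
      + (delta 𝕜 y h * r * s * q f e : 𝕜) * i4
  · rw [hr]; ring
  · rw [hs]; ring
  · rw [ht]; ring

/-! ### The coefficients of bcd and abcd -/

/-- A deletion behind the front would need the letter m (to produce c) or p (to produce b), and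
neither is available. -/
lemma isRigid_bcd (H : Config a b c d e f g m p b' h k) :
    IsRigid q {b, c, d, e, f, g} [b, c, d] := by
  have h1 : IsRigid q ({b, c, d, e, f, g} : Set X) [d] := (isRigid_nil q _).cons q (by
    intro u₁ u₂ x l0 h'
    exact absurd (List.append_eq_nil_iff.1 l0.symm).1 h')
  have h2 : IsRigid q ({b, c, d, e, f, g} : Set X) [c, d] := h1.cons q (by
    intro u₁ u₂ x l0 h' hx
    rcases u₁ with _ | ⟨y, u₁⟩
    · exact absurd rfl h'
    obtain ⟨rfl, l1⟩ := List.cons_eq_cons.1 l0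
    obtain ⟨rfl, rfl⟩ := List.append_eq_nil_iff.1 l1.symm
    rw [show x = m from (Rack.left_cancel d).1 (hx.trans H.cdm.yz.symm)]
    exact H.not_mem_m)
  refine h2.cons q ?_
  intro u₁ u₂ x l0 h' hx
  rcases u₁ with _ | ⟨y, u₁⟩
  · exact absurd rfl h'
  obtain ⟨rfl, l1⟩ := List.cons_eq_cons.1 l0
  have hx1 := (Rack.left_cancel c).1 (hx.trans H.bcp.yz.symm)
  rcases u₁ with _ | ⟨y, u₁⟩
  · rw [show x = p from hx1]; exact H.not_mem_p
  obtain ⟨rfl, l2⟩ := List.cons_eq_cons.1 l1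
  obtain ⟨rfl, rfl⟩ := List.append_eq_nil_iff.1 l2.symm
  rw [show x = p from (Rack.left_cancel d).1 (hx1.trans H.dp.symm)]
  exact H.not_mem_p

/-- To produce a behind the prefixes b, bc, bcd, the deleted letter would have to be b', h, k
respectively. At the front it would be a itself. -/
lemma symCoeff_wordsIn (H : Config a b c d e f g m p b' h k) {t : TensorAlg 𝕜 X}
    (ht : t ∈ wordsIn 𝕜 ({b, c, d, e, f, g} : Set X)) : symCoeff q [a, b, c, d] t = 0 := by
  refine IsRigid.cons_eq_zero q H.isRigid_bcd H.not_mem_a ?_ ht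
  intro u₁ u₂ x l0 h' hx
  rcases u₁ with _ | ⟨y, u₁⟩
  · exact absurd rfl h'
  obtain ⟨rfl, l1⟩ := List.cons_eq_cons.1 l0
  have hx1 := (Rack.left_cancel b).1 (hx.trans H.abb'.yz.symm)
  rcases u₁ with _ | ⟨y, u₁⟩
  · rw [show x = b' from hx1]; exact H.not_mem_b'
  obtain ⟨rfl, l2⟩ := List.cons_eq_cons.1 l1
  have hx2 := (Rack.left_cancel c).1 (hx1.trans H.b'ch.yz.symm)
  rcases u₁ with _ | ⟨y, u₁⟩
  · rw [show x = h from hx2]; exact H.not_mem_h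
  obtain ⟨rfl, l3⟩ := List.cons_eq_cons.1 l2
  obtain ⟨rfl, rfl⟩ := List.append_eq_nil_iff.1 l3.symm
  rw [show x = k from (Rack.left_cancel d).1 (hx2.trans H.dkh.xy.symm)]
  exact H.not_mem_k

lemma symCoeff_bcd (H : Config a b c d e f g m p b' h k) :
    symCoeff q [b, c, d] (word 𝕜 [b, c, d]) = 1 := by
  rw [symCoeff_cons, partialD_word_three, H.bcp.xy, H.cdm.xy, H.bm, delta_self,
    delta_of_ne H.bcp.ne''.symm, delta_of_ne H.bm_ne.symm, one_smul, mul_zero, mul_zero, mul_zero, zero_smul,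
    zero_smul, add_zero, add_zero, symCoeff_pair]
  simp [H.cdm.ne''.symm, H.cdm.xy]

/-- Among the indices of the derivatives, m, p, b', h differ from a, but k = a is not ruled out. So
∂_a Z is bcd plus possibly a multiple of gfe. By rigidity gfe contributes to bcd only if the two
words coincide, which `hne` excludes. -/
lemma symCoeff_tensorZ (H : Config a b c d e f g m p b' h k) (hX : IsBraidedRack X)
    (hslim : SlimInDegreeTwo q) (hne : e ≠ d ∨ f ≠ c ∨ g ≠ b) :
    symCoeff q [a, b, c, d] (tensorZ q a b c d) = 1 := by
  obtain ⟨r₁, r₂, r₃, r₄, r₅, hr⟩ := H.partialD_tensorZ q hX hslim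
  have h3 := hr a
  rw [delta_of_ne H.ame.ne.symm, delta_of_ne H.aph.ne.symm, delta_of_ne H.abb'.ne''.symm,
    delta_of_ne H.aph.ne''.symm, delta_self] at h3
  have h4 : toNichols q (partialD q a (tensorZ q a b c d))
      = toNichols q (word 𝕜 [b, c, d] + (r₃ * delta 𝕜 a k) • word 𝕜 [g, f, e]) := by
    rw [h3, map_add, map_smul]
    simp only [toNichols_word_cons, toNichols_word_nil, mul_one, mul_zero, zero_smul, add_zero,
      one_smul, mul_assoc]
  have h5 : symCoeff q [b, c, d] (word 𝕜 [g, f, e]) = 0 := by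
    by_contra h0
    have := H.isRigid_bcd (q := q) [g, f, e] (by simp) h0
    simp only [List.cons.injEq, and_true] at this
    obtain ⟨h6, h7, h8⟩ := this
    rcases hne with h | h | h <;> contradiction
  rw [symCoeff_cons, symCoeff_eq_of_toNichols_eq q h4, map_add, map_smul, h5, H.symCoeff_bcd,
    smul_zero, add_zero]

end Config

/-! ### The Leibniz rule for Z -/

variable {q} {a b c d e f g : X}

/-- The four words are successive rotations, so ∂_y passes all of them with the same scalar and the
same new index. -/
lemma leibniz_tensorZ (he : e = a ◃ b ◃ c ◃ d) (hf : f = e ◃ a ◃ b ◃ c) (hg : g = f ◃ e ◃ a ◃ b)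
    {r s t : 𝕜} (hz : tensorZ q a b c d = word 𝕜 [a, b, c, d] + r • word 𝕜 [e, a, b, c]
      + s • word 𝕜 [f, e, a, b] + t • word 𝕜 [g, f, e, a]) (y : X) (u : TensorAlg 𝕜 X) :
    partialD q y (tensorZ q a b c d * u) = partialD q y (tensorZ q a b c d) * u
      + invScalar q [a, b, c, d] y •
        (tensorZ q a b c d * partialD q (invWord [a, b, c, d] y) u) := by
  have h1 : invWord [e, a, b, c] y = invWord [a, b, c, d] y := he ▸ invWord_rotate a b c d y
  have h2 : invWord [f, e, a, b] y = invWord [e, a, b, c] y := hf ▸ invWord_rotate e a b c y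
  have h3 : invWord [g, f, e, a] y = invWord [f, e, a, b] y := hg ▸ invWord_rotate f e a b y
  have h4 : invScalar q [e, a, b, c] y = invScalar q [a, b, c, d] y :=
    he ▸ invScalar_rotate q a b c d y
  have h5 : invScalar q [f, e, a, b] y = invScalar q [e, a, b, c] y :=
    hf ▸ invScalar_rotate q e a b c y
  have h6 : invScalar q [g, f, e, a] y = invScalar q [f, e, a, b] y :=
    hg ▸ invScalar_rotate q f e a b y
  rw [hz]
  simp only [add_mul, map_add, smul_mul_assoc, map_smul, partialD_word_mul, h1, h2, h3, h4, h5, h6]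
  module

end RackNichols
end

noncomputable section

namespace RackNichols

variable {𝕜 : Type*} {X : Type*} [Field 𝕜] [Rack X] (q : TwoCocycle 𝕜 X)

/-! ### The left coideal subalgebra generated by `Z` -/

/-- The subalgebra of the tensor algebra generated by the letters `b`, `c`, `d`, `e`, `f`, `g` and
the tensor that represents `Z(a,b,c,d)`. -/
def tensorSubalgebra (a b c d e f g : X) : Subalgebra 𝕜 (TensorAlg 𝕜 X) :=
  Algebra.adjoin 𝕜 {word 𝕜 [b], word 𝕜 [c], word 𝕜 [d], word 𝕜 [e], word 𝕜 [f], word 𝕜 [g],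
    tensorZ q a b c d}

lemma map_tensorSubalgebra (a b c d e f g : X) :
    (tensorSubalgebra q a b c d e f g).map (toNichols q) = Algebra.adjoin 𝕜
      {gen q b, gen q c, gen q d, gen q e, gen q f, gen q g, elementZ q a b c d} := by
  rw [tensorSubalgebra, AlgHom.map_adjoin]
  simp only [Set.image_insert_eq, Set.image_singleton]
  rfl

lemma partialD_letter_mul (x y : X) (t : TensorAlg 𝕜 X) :
    partialD q y (word 𝕜 [x] * t) = partialD q y (word 𝕜 [x]) * t
      + invScalar q [x] y • (word 𝕜 [x] * partialD q (invWord [x] y) t) :=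
  partialD_word_mul q [x] y t

lemma partialD_letter_mem (x y : X) (C : Subalgebra 𝕜 (NicholsAlgebra q)) :
    toNichols q (partialD q y (word 𝕜 [x])) ∈ C := by
  rw [partialD_word_cons, partialD_nil, map_zero, smul_zero, add_zero, map_smul,
    toNichols_word_nil]
  exact C.smul_mem (one_mem C) _

lemma gen_mem_degreePart (x : X) : gen q x ∈ degreePart q 1 :=
  ⟨word 𝕜 [x], Submodule.subset_span ⟨[x], rfl, rfl⟩, rfl⟩

lemma gen_mem_groupPart (x : X) : gen q x ∈ groupPart q (envelDegree [x]) :=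
  ⟨word 𝕜 [x], Submodule.subset_span ⟨[x], rfl, rfl⟩, rfl⟩

variable {q} {a b c d e f g m p b' h k : X}

lemma Config.tensorZ_eq_rotate (H : Config a b c d e f g m p b' h k) (hX : IsBraidedRack X) :
    ∃ r s t : 𝕜, tensorZ q a b c d = word 𝕜 [a, b, c, d] + r • word 𝕜 [e, a, b, c]
      + s • word 𝕜 [f, e, a, b] + t • word 𝕜 [g, f, e, a] := by
  have hz := H.tensorZ_eq (q := q) hX rfl rfl rfl
  rw [sub_eq_add_neg, sub_eq_add_neg, ← neg_smul, ← neg_smul] at hz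
  exact ⟨_, _, _, hz⟩

lemma Config.tensorZ_mem (H : Config a b c d e f g m p b' h k) (hX : IsBraidedRack X)
    (P : List X → Prop) (h1 : P [a, b, c, d]) (h2 : P [e, a, b, c]) (h3 : P [f, e, a, b])
    (h4 : P [g, f, e, a]) :
    tensorZ q a b c d ∈ Submodule.span 𝕜 {t | ∃ w, P w ∧ t = word 𝕜 w} := by
  obtain ⟨r, s, t, hz⟩ := H.tensorZ_eq_rotate (q := q) hX
  rw [hz]
  exact add_mem (add_mem (add_mem (Submodule.subset_span ⟨_, h1, rfl⟩)
    (Submodule.smul_mem _ _ (Submodule.subset_span ⟨_, h2, rfl⟩)))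
    (Submodule.smul_mem _ _ (Submodule.subset_span ⟨_, h3, rfl⟩)))
    (Submodule.smul_mem _ _ (Submodule.subset_span ⟨_, h4, rfl⟩))

lemma Config.partialD_mem (H : Config a b c d e f g m p b' h k) (hX : IsBraidedRack X)
    (hslim : SlimInDegreeTwo q) (he : e = a ◃ b ◃ c ◃ d) (hf : f = e ◃ a ◃ b ◃ c)
    (hg : g = f ◃ e ◃ a ◃ b) (t : TensorAlg 𝕜 X)
    (ht : toNichols q t ∈ (tensorSubalgebra q a b c d e f g).map (toNichols q)) (y : X) :
    toNichols q (partialD q y t) ∈ (tensorSubalgebra q a b c d e f g).map (toNichols q) := by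
  refine partialD_mem_adjoin q _ _ rfl ?_ t ht y
  have hS : ∀ x, word 𝕜 [x] ∈ tensorSubalgebra q a b c d e f g →
      gen q x ∈ (tensorSubalgebra q a b c d e f g).map (toNichols q) := fun x hx =>
    Subalgebra.mem_map.2 ⟨_, hx, rfl⟩
  have hb := hS b (Algebra.subset_adjoin (by simp))
  have hc := hS c (Algebra.subset_adjoin (by simp))
  have hd := hS d (Algebra.subset_adjoin (by simp))
  have he' := hS e (Algebra.subset_adjoin (by simp))
  have hf' := hS f (Algebra.subset_adjoin (by simp))
  have hg' := hS g (Algebra.subset_adjoin (by simp))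
  have hletter : ∀ x y : X, toNichols q (partialD q y (word 𝕜 [x]))
      ∈ (tensorSubalgebra q a b c d e f g).map (toNichols q) ∧ ∃ (r : 𝕜) (z : X), ∀ t,
      partialD q y (word 𝕜 [x] * t) = partialD q y (word 𝕜 [x]) * t
        + r • (word 𝕜 [x] * partialD q z t) := fun x y =>
    ⟨partialD_letter_mem q x y _, _, _, partialD_letter_mul q x y⟩
  rintro s (rfl | rfl | rfl | rfl | rfl | rfl | rfl) y
  iterate 6 exact hletter _ y
  obtain ⟨r, s, t, hz⟩ := H.tensorZ_eq_rotate (q := q) hX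
  refine ⟨?_, _, _, leibniz_tensorZ he hf hg hz y⟩
  obtain ⟨r₁, r₂, r₃, r₄, r₅, hr⟩ := H.partialD_tensorZ q hX hslim
  rw [hr]
  exact add_mem (add_mem (add_mem (add_mem (add_mem
    (Subalgebra.smul_mem _ (mul_mem (mul_mem hb hc) hd) _)
    (Subalgebra.smul_mem _ (mul_mem (mul_mem he' hb) hc) _))
    (Subalgebra.smul_mem _ (mul_mem (mul_mem hf' he') hb) _))
    (Subalgebra.smul_mem _ (mul_mem (mul_mem hg' hf') he') _))
    (Subalgebra.smul_mem _ (mul_mem (mul_mem hc hd) hg') _))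
    (Subalgebra.smul_mem _ (mul_mem (mul_mem hd hg') hf') _)

lemma Config.isGradedLeftCoidealSubalgebra (H : Config a b c d e f g m p b' h k)
    (hX : IsBraidedRack X) (hslim : SlimInDegreeTwo q) (he : e = a ◃ b ◃ c ◃ d)
    (hf : f = e ◃ a ◃ b ◃ c) (hg : g = f ◃ e ◃ a ◃ b) :
    IsGradedLeftCoidealSubalgebra q (Algebra.adjoin 𝕜
      {gen q b, gen q c, gen q d, gen q e, gen q f, gen q g, elementZ q a b c d}) := by
  refine ⟨?_, toSubmodule_adjoin_graded q _ ?_, toSubmodule_adjoin_subcomodule q _ ?_⟩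
  · rw [← map_tensorSubalgebra]
    exact fun x hx => comul_mem_of_partialD q _ (H.partialD_mem hX hslim he hf hg) hx
  · rintro s (rfl | rfl | rfl | rfl | rfl | rfl | rfl)
    iterate 6 exact ⟨1, gen_mem_degreePart q _⟩
    exact ⟨4, _, H.tensorZ_mem hX (fun w => w.length = 4) rfl rfl rfl rfl, rfl⟩
  · rintro s (rfl | rfl | rfl | rfl | rfl | rfl | rfl)
    iterate 6 exact ⟨_, gen_mem_groupPart q _⟩
    have h1 : envelDegree [e, a, b, c] = envelDegree [a, b, c, d] := he ▸ envelDegree_rotate a b c d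
    have h2 : envelDegree [f, e, a, b] = envelDegree [e, a, b, c] := hf ▸ envelDegree_rotate e a b c
    have h3 : envelDegree [g, f, e, a] = envelDegree [f, e, a, b] := hg ▸ envelDegree_rotate f e a b
    exact ⟨envelDegree [a, b, c, d], _,
      H.tensorZ_mem hX (fun w => envelDegree w = envelDegree [a, b, c, d]) rfl h1 (h2.trans h1)
        (h3.trans (h2.trans h1)), rfl⟩

/-- All words in the tensor of Z have length four, so Z adds nothing to C(1). Generation in degree
one would then represent Z by words in the six letters, and the coefficient of abcd would be both 0
and 1. -/
lemma Config.not_generatedInDegreeOne (H : Config a b c d e f g m p b' h k)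
    (hX : IsBraidedRack X) (hslim : SlimInDegreeTwo q) (hne : e ≠ d ∨ f ≠ c ∨ g ≠ b) :
    ¬ GeneratedInDegreeOne q (Algebra.adjoin 𝕜
      {gen q b, gen q c, gen q d, gen q e, gen q f, gen q g, elementZ q a b c d}) := by
  intro hgen
  have h1 : tensorSubalgebra q a b c d e f g
      ≤ wordsInOrLong 𝕜 ({b, c, d, e, f, g} : Set X) 2 := by
    refine Algebra.adjoin_le ?_
    rintro s (rfl | rfl | rfl | rfl | rfl | rfl | rfl)
    iterate 6 exact Submodule.subset_span ⟨_, Or.inl (by simp), rfl⟩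
    refine H.tensorZ_mem hX _ ?_ ?_ ?_ ?_
    all_goals exact Or.inr (by simp)
  have h2 : elementZ q a b c d ∈ (wordsIn 𝕜 ({b, c, d, e, f, g} : Set X)).map (toNichols q) := by
    have h3 : elementZ q a b c d ∈ Algebra.adjoin 𝕜
        {gen q b, gen q c, gen q d, gen q e, gen q f, gen q g, elementZ q a b c d} :=
      Algebra.subset_adjoin (by simp)
    rw [hgen] at h3
    refine Algebra.adjoin_le ?_ h3
    rintro x ⟨hx, hx1⟩
    rw [← map_tensorSubalgebra] at hx
    obtain ⟨t, ht, rfl⟩ := Subalgebra.mem_map.1 hx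
    exact mem_map_wordsIn_of_degree_one q (h1 ht) hx1
  obtain ⟨t, ht, htz⟩ := Subalgebra.mem_map.1 h2
  have h4 := symCoeff_eq_of_toNichols_eq q (show toNichols q t = toNichols q (tensorZ q a b c d)
    from htz) [a, b, c, d]
  rw [H.symCoeff_wordsIn ht, H.symCoeff_tensorZ hX hslim hne] at h4
  exact zero_ne_one h4

end RackNichols

end

theorem mainTheorem7 {𝕜 : Type*} [Field 𝕜] [IsAlgClosed 𝕜] [CharZero 𝕜]
    {G : Type*} [Group G] {X : Type*} [Rack X] (j : X →◃ Quandle.Conj G)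
    (hj : RackNichols.IsUnionOfConjClasses j) (q : RackNichols.TwoCocycle 𝕜 X)
    (hX : RackNichols.IsBraidedRack X) (hslim : RackNichols.SlimInDegreeTwo q) (a b c d : X)
    (hab : a ◃ b ≠ b) (had : a ◃ d ≠ d) (hbc : b ◃ c ≠ c) (hbd : b ◃ d ≠ d) (hcd : c ◃ d ≠ d)
    (hac : RackNichols.CommuteDistinct a c) (hbcd : RackNichols.CommuteDistinct b (c ◃ d))
    (habd : RackNichols.CommuteDistinct a (b ◃ d))
    (e f g : X) (he : e = a ◃ b ◃ c ◃ d) (hf : f = e ◃ a ◃ b ◃ c) (hg : g = f ◃ e ◃ a ◃ b)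
    (C : Subalgebra 𝕜 (RackNichols.NicholsAlgebra q))
    (hC : C = Algebra.adjoin 𝕜 {RackNichols.gen q b, RackNichols.gen q c, RackNichols.gen q d,
      RackNichols.gen q e, RackNichols.gen q f, RackNichols.gen q g,
      RackNichols.elementZ q a b c d}) :
    RackNichols.IsGradedLeftCoidealSubalgebra q C ∧
      (e ≠ d ∨ f ≠ c ∨ g ≠ b → ¬ RackNichols.GeneratedInDegreeOne q C) := by
  have H := hX.config hab had hbc hbd hcd hac hbcd habd
  -- The letters brought to the front by the rotations are identified with the shorter products used
  -- in the configuration.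
  have he' : e = a ◃ c ◃ d := by rw [he, H.bm]
  have hf' : f = b ◃ d := by rw [hf, he', H.e_act_h hX]
  have hg' : g = a ◃ d := by rw [hg, hf', he', H.eb', H.f_act_b']
  rw [← he', ← hf', ← hg'] at H
  rw [hC]
  exact ⟨H.isGradedLeftCoidealSubalgebra hX hslim he hf hg, H.not_generatedInDegreeOne hX hslim⟩
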